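/- All systems are finite-dimensional. A system is a nonzero Hilbert space with a fixed decomposition into superselection sectors (one sector: a quantum system; all sectors one-dimensional: a classical system). Transformations $A\to B$ are completely positive (CP) maps between the corresponding algebras of block-diagonal operators, states of $A$ are transformations from the trivial system to $A$, and "causal" means trace-preserving. For a transformation $V$ with input subsystems $(A_i)_{i\in I}$ and output subsystems $(B_j)_{j\in J}$, say that $A_i$ does not influence $B_j$ through $V$ if there is a causal transformation $T:\bigotimes_{k\ne i}A_k\to B_j$ with $\mathrm{Tr}_{\text{all outputs but }B_j}\circ V = T\circ \mathrm{Tr}_{A_i}$; otherwise $A_i$ influences $B_j$. (1) Let $n\ge 1$ and let $V:A_1\otimes\cdots\otimes A_n\otimes\lambda\to A_1'\otimes\cdots\otimes A_n'\otimes F$ be a unitary channel $\rho\mapsto U\rho U^\dagger$ between quantum systems such that $A_i$ does not influence $A_j'$ through $V$ for all $i\ne j$. Then $V$ decomposes separably: there are systems $X_1,\dots,X_n,Y_1,\dots,Y_n$ and causal transformations $T_0:\lambda\to X_1\otimes\cdots\otimes X_n$, $T_i:A_i\otimes X_i\to A_i'\otimes Y_i$ $(1\le i\le n)$ and $R:Y_1\otimes\cdots\otimes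 Y_n\to F$ such that, up to the canonical reorderings of tensor factors, $$V=(\mathrm{id}_{A_1'\otimes\cdots\otimes A_n'}\otimes R)\circ(T_1\otimes\cdots\otimes T_n)\circ(\mathrm{id}_{A_1\otimes\cdots\otimes A_n}\otimes T_0).$$ (2) Consider any perspectival theory over this quantum theory, that is, any set of memory updates (transformations of type $S\to M\otimes S$), any bijection from the probability extractors (causal transformations from some $S$ to a classical system) onto the memory updates that sends an extractor on $S$ to an update on $S$, and any specification of which embeddings of the input and output subsystems of transformations into points of smooth Lorentzian manifolds are valid. Let the fundamental transformations be the unitary channels between quantum systems. Then the theory has Separable Dynamics: every fundamental $V$ of the form in (1), with the no-influence property in (1), decomposes separably as in (1). If, moreover, the theory satisfies - No Superluminal Influences: in no valid embedding of a fundamental transformation does an input subsystem influence an output subsystem that is spacelike separated from it; and - Consistent Embeddings: whenever an embedding of $T:\bigotimes_i A_i\to\bigotimes_j B_j$ is valid, there are a fundamental $V:\bigotimes_i A_i\otimes\lambda\to\bigotimes_j B_j\otimes F$ and a state $\psi$ of $\lambda$ with $T=\mathrm{Tr}_F\circ V\circ(\mathrm{id}\otimes\psi)$, and a valid embedding of $V$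 in the same manifold that agrees with the given one on all $A_i$ and $B_j$ (if some $A_i$ or $B_j$ has several sectors, $V$ acts on the underlying quantum systems, and the decoherence maps of $\bigotimes_i A_i$ and $\bigotimes_j B_j$ are applied before and after), then it has Local Dynamics: for every $n\ge1$, if $T:A_1\otimes\cdots\otimes A_n\to A_1'\otimes\cdots\otimes A_n'$ has a valid embedding into a Lorentzian manifold in which, for all $i\ne j$, the points of $A_i$ and $A_i'$ are both spacelike separated from those of $A_j$ and $A_j'$ (distinct points, not connected by a smooth causal curve), then there are systems $X_1,\dots,X_n$, a state $\varphi$ of $X_1\otimes\cdots\otimes X_n$ and causal transformations $T_i:A_i\otimes X_i\to A_i'$ with $T=(T_1\otimes\cdots\otimes T_n)\circ(\mathrm{id}_{A_1\otimes\cdots\otimes A_n}\otimes\varphi)$ up to the canonical reordering of tensor factors. -/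

import Mathlib

open scoped Matrix Manifold ContDiff ComplexOrder

noncomputable section

namespace QPT

/-! ### Linear maps between matrix algebras -/

/-- Operators on the Hilbert space `ℂ^ι`, as matrices in the standard basis. -/
abbrev Op (ι : Type) : Type := Matrix ι ι ℂ

/-- Relabelling of the basis: used for the canonical reorderings of tensor factors (wires). -/
def relabel {ι κ : Type} (e : ι ≃ κ) : Op ι →ₗ[ℂ] Op κ :=
  (Matrix.reindexLinearEquiv ℂ ℂ e e).toLinearMap

/-- The tensor product `S ⊗ T` of two linear maps between matrix algebras, where
`ℂ^ι ⊗ ℂ^κ` is `ℂ^(ι × κ)`. It is the linear map with `E_{ac} ⊗ E_{bd} ↦ S E_{ac} ⊗ T E_{bd}`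
on matrix units. -/
def tensorMap {ι κ ι' κ' : Type} [Fintype ι] [DecidableEq ι] [Fintype κ] [DecidableEq κ]
    (S : Op ι →ₗ[ℂ] Op ι') (T : Op κ →ₗ[ℂ] Op κ') : Op (ι × κ) →ₗ[ℂ] Op (ι' × κ') :=
  ∑ x : ι × κ, ∑ y : ι × κ,
    (Matrix.entryLinearMap ℂ ℂ x y).smulRight
      (Matrix.kroneckerMap (· * ·) (S (Matrix.single x.1 y.1 1)) (T (Matrix.single x.2 y.2 1)))

/-- The tensor product `⊗ᵢ Tᵢ` of a finite family of linear maps between matrix algebras, where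
`⊗ᵢ ℂ^(α i)` is `ℂ^(∀ i, α i)`. -/
def piTensorMap {I : Type} [Fintype I] [DecidableEq I] {α β : I → Type}
    [∀ i, Fintype (α i)] [∀ i, DecidableEq (α i)]
    (T : ∀ i, Op (α i) →ₗ[ℂ] Op (β i)) : Op (∀ i, α i) →ₗ[ℂ] Op (∀ i, β i) :=
  ∑ x : ∀ i, α i, ∑ y : ∀ i, α i,
    (Matrix.entryLinearMap ℂ ℂ x y).smulRight
      (Matrix.of fun x' y' : ∀ i, β i =>
        ∏ i, T i (Matrix.single (x i) (y i) 1) (x' i) (y' i))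

/-- `T` is completely positive: `T ⊗ id_k` preserves positive semidefiniteness for every `k`. -/
def IsCP {ι κ : Type} [Fintype ι] [DecidableEq ι] (T : Op ι →ₗ[ℂ] Op κ) : Prop :=
  ∀ (k : ℕ) (M : Op (ι × Fin k)), M.PosSemidef →
    (tensorMap T (LinearMap.id : Op (Fin k) →ₗ[ℂ] Op (Fin k)) M).PosSemidef

/-- The trace, as a map to operators on the trivial system. -/
def traceMap (ι : Type) [Fintype ι] : Op ι →ₗ[ℂ] Op Unit :=
  (Matrix.traceLinearMap ι ℂ ℂ).smulRight 1

/-- Trace out the right factor. -/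
def discardRight (ι κ : Type) [Fintype ι] [DecidableEq ι] [Fintype κ] [DecidableEq κ] :
    Op (ι × κ) →ₗ[ℂ] Op ι :=
  relabel (Equiv.prodPUnit ι) ∘ₗ tensorMap LinearMap.id (traceMap κ)

/-- Insert an operator (given as a map out of the trivial system) on a new right factor. -/
def insertRight (ι : Type) {κ : Type} [Fintype ι] [DecidableEq ι] (φ : Op Unit →ₗ[ℂ] Op κ) :
    Op ι →ₗ[ℂ] Op (ι × κ) :=
  tensorMap LinearMap.id φ ∘ₗ relabel (Equiv.prodPUnit ι).symm

/-- Trace out the `i`-th factor of a finite family. -/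
def discardAt {I : Type} [Fintype I] [DecidableEq I] (α : I → Type)
    [∀ i, Fintype (α i)] [∀ i, DecidableEq (α i)] (i : I) :
    Op (∀ k, α k) →ₗ[ℂ] Op (∀ k : {k // k ≠ i}, α k) :=
  discardRight (∀ k : {k // k ≠ i}, α k) (α i) ∘ₗ
    relabel ((Equiv.piSplitAt i α).trans (Equiv.prodComm _ _))

/-- Trace out all factors of a finite family except the `j`-th. -/
def discardAllBut {J : Type} [Fintype J] [DecidableEq J] (β : J → Type)
    [∀ j, Fintype (β j)] [∀ j, DecidableEq (β j)] (j : J) :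
    Op (∀ k, β k) →ₗ[ℂ] Op (β j) :=
  discardRight (β j) (∀ k : {k // k ≠ j}, β k) ∘ₗ relabel (Equiv.piSplitAt j β)

/-! ### Systems and transformations of finite-dimensional quantum theory -/

/-- A finite-dimensional system: a nonzero Hilbert space `ℂ^Basis` with its basis partitioned into
superselection sectors. One sector: a quantum system. All sectors one-dimensional: a classical
system. In general, the algebra of the system consists of the block-diagonal matrices. -/
structure System where
  Basis : Type
  [fintype : Fintype Basis]
  [decEq : DecidableEq Basis]
  [nonempty : Nonempty Basis]
  sectors : Setoid Basis

attribute [instance] System.fintype System.decEq System.nonempty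

namespace System

def IsQuantum (A : System) : Prop := A.sectors = ⊤

def IsClassical (A : System) : Prop := A.sectors = ⊥

/-- The trivial system `I`. -/
def unit : System where
  Basis := Unit
  sectors := ⊤

/-- `A ⊗ B`. -/
def prod (A B : System) : System where
  Basis := A.Basis × B.Basis
  sectors := A.sectors.prod B.sectors

/-- `⊗ᵢ Aᵢ`. -/
def pi {I : Type} [Fintype I] [DecidableEq I] (A : I → System) : System where
  Basis := ∀ i, (A i).Basis
  sectors := @piSetoid I (fun i => (A i).Basis) (fun i => (A i).sectors)

/-- The family `(Aᵢ)ᵢ` together with one further system `L`. -/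
def extend {I : Type} (A : I → System) (L : System) : Option I → System
  | none => L
  | some i => A i

/-- The quantum system underlying `A`: same Hilbert space, no superselection. -/
def coherent (A : System) : System where
  Basis := A.Basis
  sectors := ⊤

open Classical in
/-- Decoherence of `A`: the projection onto the block-diagonal matrices. It is the identity
transformation of `A`. -/
def decohere (A : System) : Op A.Basis →ₗ[ℂ] Op A.Basis where
  toFun ρ := Matrix.of fun a b => if A.sectors a b then ρ a b else 0
  map_add' ρ σ := by
    ext a b
    by_cases h : A.sectors a b <;> simp [h]
  map_smul' c ρ := by
    ext a b
    by_cases h : A.sectors a b <;> simp [h]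

/-- `(⊗ᵢ Aᵢ) ⊗ L` regrouped as a tensor product over the extended family, at the level of basis
labels. -/
def extendEquiv {I : Type} (A : I → System) (L : System) :
    ((∀ i, (A i).Basis) × L.Basis) ≃ (∀ o, (extend A L o).Basis) where
  toFun p
    | none => p.2
    | some i => p.1 i
  invFun x := (fun i => x (some i), x none)
  left_inv _ := rfl
  right_inv x := by
    funext o
    cases o <;> rfl

end System

/-- A transformation `A → B`: a completely positive map between the algebras of block-diagonal
matrices of `A` and `B`, represented as a completely positive map of full matrix algebras that
absorbs decoherence on both sides. States of `A` are transformations `System.unit → A`. -/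
@[ext]
structure Transformation (A B : System) where
  map : Op A.Basis →ₗ[ℂ] Op B.Basis
  cp : IsCP map
  map_decohere : map ∘ₗ A.decohere = map
  decohere_map : B.decohere ∘ₗ map = map

namespace Transformation

/-- Normalization preservation (trace preservation). -/
def IsCausal {A B : System} (T : Transformation A B) : Prop :=
  ∀ ρ, (T.map ρ).trace = ρ.trace

/-- `V` is a unitary channel `ρ ↦ U ρ U†` between quantum systems. -/
def IsUnitary {A B : System} (V : Transformation A B) : Prop :=
  A.IsQuantum ∧ B.IsQuantum ∧ ∃ U : Matrix B.Basis A.Basis ℂ,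
    Uᴴ * U = 1 ∧ U * Uᴴ = 1 ∧ ∀ ρ, V.map ρ = U * ρ * Uᴴ

variable {I J : Type} [Fintype I] [DecidableEq I] [Fintype J] [DecidableEq J]
  {A : I → System} {B : J → System}

/-- The input `A i` does not influence the output `B j` through `V`: tracing out all outputs but
`B j` amounts to tracing out `A i` and applying some trace-preserving transformation `T` to the
other inputs. -/
def NoInfluence (V : Transformation (System.pi A) (System.pi B)) (i : I) (j : J) : Prop :=
  ∃ T : Transformation (System.pi fun k : {k // k ≠ i} => A k) (B j), T.IsCausal ∧
    discardAllBut (fun j => (B j).Basis) j ∘ₗ V.map =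
      T.map ∘ₗ discardAt (fun i => (A i).Basis) i

def Influences (V : Transformation (System.pi A) (System.pi B)) (i : I) (j : J) : Prop :=
  ¬ V.NoInfluence i j

end Transformation

/-! ### The decompositions -/

section Circuits

variable {n : ℕ}

/-- The circuit for separable dynamics
`A₁ ⊗ ⋯ ⊗ Aₙ ⊗ L → A'₁ ⊗ ⋯ ⊗ A'ₙ ⊗ F`: first `T₀ : L → X₁ ⊗ ⋯ ⊗ Xₙ`, then in parallel
`Tᵢ : Aᵢ ⊗ Xᵢ → A'ᵢ ⊗ Yᵢ`, and then `R : Y₁ ⊗ ⋯ ⊗ Yₙ → F`. -/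
def separableCircuit {A A' X Y : Fin n → System} {L F : System}
    (T₀ : Transformation L (System.pi X))
    (T : ∀ i, Transformation ((A i).prod (X i)) ((A' i).prod (Y i)))
    (R : Transformation (System.pi Y) F) :
    Op (System.pi (System.extend A L)).Basis →ₗ[ℂ] Op (System.pi (System.extend A' F)).Basis :=
  relabel (System.extendEquiv A' F) ∘ₗ
  tensorMap (LinearMap.id : Op (∀ i, (A' i).Basis) →ₗ[ℂ] _) R.map ∘ₗ
  relabel (Equiv.arrowProdEquivProdArrow (Fin n)
    (fun i => (A' i).Basis) (fun i => (Y i).Basis)) ∘ₗ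
  piTensorMap (α := fun i => (A i).Basis × (X i).Basis)
    (β := fun i => (A' i).Basis × (Y i).Basis) (fun i => (T i).map) ∘ₗ
  relabel (Equiv.arrowProdEquivProdArrow (Fin n)
    (fun i => (A i).Basis) (fun i => (X i).Basis)).symm ∘ₗ
  tensorMap (LinearMap.id : Op (∀ i, (A i).Basis) →ₗ[ℂ] _) T₀.map ∘ₗ
  relabel (System.extendEquiv A L).symm

/-- The circuit for local dynamics `A₁ ⊗ ⋯ ⊗ Aₙ → A'₁ ⊗ ⋯ ⊗ A'ₙ`: a state `φ` of
`X₁ ⊗ ⋯ ⊗ Xₙ` is prepared, and then `Tᵢ : Aᵢ ⊗ Xᵢ → A'ᵢ` act in parallel. -/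
def localCircuit {A A' X : Fin n → System}
    (φ : Transformation System.unit (System.pi X))
    (T : ∀ i, Transformation ((A i).prod (X i)) (A' i)) :
    Op (System.pi A).Basis →ₗ[ℂ] Op (System.pi A').Basis :=
  piTensorMap (α := fun i => (A i).Basis × (X i).Basis)
    (β := fun i => (A' i).Basis) (fun i => (T i).map) ∘ₗ
  relabel (Equiv.arrowProdEquivProdArrow (Fin n)
    (fun i => (A i).Basis) (fun i => (X i).Basis)).symm ∘ₗ
  insertRight (∀ i, (A i).Basis) φ.map

/-- `V` decomposes as in the diagram for separable dynamics, with normalization-preserving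
components. -/
def DecomposesSeparably {A A' : Fin n → System} {L F : System}
    (V : Transformation (System.pi (System.extend A L)) (System.pi (System.extend A' F))) :
    Prop :=
  ∃ (X Y : Fin n → System)
    (T₀ : Transformation L (System.pi X))
    (T : ∀ i, Transformation ((A i).prod (X i)) ((A' i).prod (Y i)))
    (R : Transformation (System.pi Y) F),
    T₀.IsCausal ∧ (∀ i, (T i).IsCausal) ∧ R.IsCausal ∧ V.map = separableCircuit T₀ T R

/-- `T` decomposes as in the diagram for local dynamics, with normalization-preserving `Tᵢ`. -/
def DecomposesLocally {A A' : Fin n → System}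
    (T : Transformation (System.pi A) (System.pi A')) : Prop :=
  ∃ (X : Fin n → System) (φ : Transformation System.unit (System.pi X))
    (S : ∀ i, Transformation ((A i).prod (X i)) (A' i)),
    (∀ i, (S i).IsCausal) ∧ T.map = localCircuit φ S

end Circuits

/-- `T : ⊗ᵢ Aᵢ → ⊗ⱼ Bⱼ` is obtained from `V : ⊗ᵢ Aᵢ ⊗ L → ⊗ⱼ Bⱼ ⊗ F` by inserting a state `ψ` on
`L` and tracing out `F`. A system with superselection sectors is here regarded as a decohered
quantum system; if all `Aᵢ` and `Bⱼ` are quantum then `A.coherent = A` and both decoherence maps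
are identities. -/
def ObtainedFrom {I J : Type} [Fintype I] [DecidableEq I] [Fintype J] [DecidableEq J]
    {A : I → System} {B : J → System} {L F : System}
    (T : Transformation (System.pi A) (System.pi B))
    (V : Transformation (System.pi (System.extend (fun i => (A i).coherent) L))
      (System.pi (System.extend (fun j => (B j).coherent) F))) : Prop :=
  ∃ ψ : Transformation System.unit L,
    T.map = (System.pi B).decohere ∘ₗ
      discardRight (∀ j, (B j).Basis) F.Basis ∘ₗ
      relabel (System.extendEquiv (fun j => (B j).coherent) F).symm ∘ₗ
      V.map ∘ₗ
      relabel (System.extendEquiv (fun i => (A i).coherent) L) ∘ₗ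
      insertRight (∀ i, (A i).Basis) ψ.map ∘ₗ
      (System.pi A).decohere

/-! ### Lorentzian manifolds -/

/-- A smooth Lorentzian manifold of dimension `d + 1`, with signature `(-, +, …, +)`. -/
structure LorentzianManifold where
  d : ℕ
  Point : Type
  [top : TopologicalSpace Point]
  [t2 : T2Space Point]
  [secondCountable : SecondCountableTopology Point]
  [charted : ChartedSpace (EuclideanSpace ℝ (Fin (d + 1))) Point]
  [manifold : IsManifold (𝓡 (d + 1)) ∞ Point]
  metric : ∀ p : Point,
    TangentSpace (𝓡 (d + 1)) p →L[ℝ] TangentSpace (𝓡 (d + 1)) p →L[ℝ] ℝ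
  symm : ∀ p v w, metric p v w = metric p w v
  lorentzian : ∀ p, ∃ v, metric p v v < 0 ∧
    ∀ w, metric p v w = 0 → w ≠ 0 → 0 < metric p w w
  smooth : ContMDiff (𝓡 (d + 1))
    ((𝓡 (d + 1)).prod 𝓘(ℝ, EuclideanSpace ℝ (Fin (d + 1)) →L[ℝ]
      EuclideanSpace ℝ (Fin (d + 1)) →L[ℝ] ℝ)) ∞
    (fun p => Bundle.TotalSpace.mk' (EuclideanSpace ℝ (Fin (d + 1)) →L[ℝ]
      EuclideanSpace ℝ (Fin (d + 1)) →L[ℝ] ℝ)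
      (E := fun p : Point =>
        TangentSpace (𝓡 (d + 1)) p →L[ℝ] TangentSpace (𝓡 (d + 1)) p →L[ℝ] ℝ) p (metric p))

attribute [instance] LorentzianManifold.top LorentzianManifold.t2
  LorentzianManifold.secondCountable LorentzianManifold.charted LorentzianManifold.manifold

/-- There is a smooth causal curve from `p` to `q`: its velocity is everywhere nonzero and timelike
or null. The reversed curve is then causal from `q` to `p`. -/
def LorentzianManifold.CausalCurve (M : LorentzianManifold) (p q : M.Point) : Prop :=
  ∃ γ : ℝ → M.Point, ContMDiff 𝓘(ℝ, ℝ) (𝓡 (M.d + 1)) ∞ γ ∧ γ 0 = p ∧ γ 1 = q ∧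
    ∀ t ∈ Set.Icc (0 : ℝ) 1,
      mfderiv 𝓘(ℝ, ℝ) (𝓡 (M.d + 1)) γ t (1 : ℝ) ≠ 0 ∧
      M.metric (γ t) (mfderiv 𝓘(ℝ, ℝ) (𝓡 (M.d + 1)) γ t (1 : ℝ))
        (mfderiv 𝓘(ℝ, ℝ) (𝓡 (M.d + 1)) γ t (1 : ℝ)) ≤ 0

/-- Distinct points that are not connected by a causal curve. -/
def LorentzianManifold.Spacelike (M : LorentzianManifold) (p q : M.Point) : Prop :=
  p ≠ q ∧ ¬ M.CausalCurve p q

/-! ### Perspectival theories -/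

/-- A probability extractor: a normalization-preserving transformation to a classical system. -/
structure Extractor where
  S : System
  X : System
  classical : X.IsClassical
  T : Transformation S X
  causal : T.IsCausal

/-- A transformation of the type `S → M ⊗ S` of a memory update. -/
structure UpdateType where
  S : System
  M : System
  U : Transformation S (M.prod S)

/-- A perspectival theory over finite-dimensional quantum theory: a set of memory updates, a
bijection from the extractors to the memory updates, and a specification of which embeddings of
the input and output subsystems of a transformation into a Lorentzian manifold are valid. -/
structure QuantumPerspectivalTheory where
  memoryUpdates : Set UpdateType
  update : Extractor ≃ memoryUpdates
  update_system : ∀ E, (update E).1.S = E.S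
  Valid : ∀ (M : LorentzianManifold) {I J : Type} [Fintype I] [DecidableEq I] [Fintype J]
    [DecidableEq J] {A : I → System} {B : J → System},
    Transformation (System.pi A) (System.pi B) → (I → M.Point) → (J → M.Point) → Prop

namespace QuantumPerspectivalTheory

/-- The fundamental transformations are the unitary channels. -/
def IsFundamental (_ : QuantumPerspectivalTheory) {A B : System} (V : Transformation A B) : Prop :=
  V.IsUnitary

def NoSuperluminalInfluences (Q : QuantumPerspectivalTheory) : Prop :=
  ∀ (M : LorentzianManifold) (I J : Type) [Fintype I] [DecidableEq I] [Fintype J] [DecidableEq J]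
    (A : I → System) (B : J → System) (V : Transformation (System.pi A) (System.pi B))
    (E : I → M.Point) (E' : J → M.Point),
    Q.IsFundamental V → Q.Valid M V E E' →
      ∀ i j, V.Influences i j → ¬ M.Spacelike (E i) (E' j)

/-- Each valid embedding of a transformation extends to a valid embedding of a fundamental
transformation from which it is obtained. -/
def ConsistentEmbeddings (Q : QuantumPerspectivalTheory) : Prop :=
  ∀ (M : LorentzianManifold) (I J : Type) [Fintype I] [DecidableEq I] [Fintype J] [DecidableEq J]
    (A : I → System) (B : J → System) (T : Transformation (System.pi A) (System.pi B))
    (E : I → M.Point) (E' : J → M.Point), Q.Valid M T E E' →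
      ∃ (L F : System)
        (V : Transformation (System.pi (System.extend (fun i => (A i).coherent) L))
          (System.pi (System.extend (fun j => (B j).coherent) F)))
        (G : Option I → M.Point) (G' : Option J → M.Point),
        Q.IsFundamental V ∧ ObtainedFrom T V ∧ Q.Valid M V G G' ∧
          (∀ i, G (some i) = E i) ∧ (∀ j, G' (some j) = E' j)

def SeparableDynamics (Q : QuantumPerspectivalTheory) : Prop :=
  ∀ (n : ℕ), 0 < n → ∀ (A A' : Fin n → System) (L F : System)
    (V : Transformation (System.pi (System.extend A L)) (System.pi (System.extend A' F))),
    Q.IsFundamental V → (∀ i j, i ≠ j → ¬ V.Influences (some i) (some j)) →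
      DecomposesSeparably V

def LocalDynamics (Q : QuantumPerspectivalTheory) : Prop :=
  ∀ (M : LorentzianManifold) (n : ℕ), 0 < n → ∀ (A A' : Fin n → System)
    (T : Transformation (System.pi A) (System.pi A')) (E E' : Fin n → M.Point),
    Q.Valid M T E E' →
    (∀ i j, i ≠ j → M.Spacelike (E i) (E j) ∧ M.Spacelike (E i) (E' j) ∧
      M.Spacelike (E' i) (E j) ∧ M.Spacelike (E' i) (E' j)) →
    DecomposesLocally T

end QuantumPerspectivalTheory

end QPT

end

/-!
A unitary channel `V` in which no input `Aᵢ` influences an output `A'ⱼ` with `j ≠ i` is analysed in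
the Heisenberg picture. The absence of influence says that, for every operator `a` on `A'ᵢ`, the
evolved operator `U† (a ⊗ 1) U` acts on `Aᵢ ⊗ L` only (`heisenberg_entry`, `exists_eq_lift`). These
operators form a representation of the matrix algebra of `A'ᵢ` on `Aᵢ ⊗ L`, and they commute for
different `i`, because the outputs do. Hence their components on `L` generate pairwise commuting
star-algebras (`commute_slice`).

Commuting star-algebras on `L` can be distributed over several systems `Xᵢ`: there is an isometry
`J : L → ⊗ᵢ Xᵢ` that turns the action of the `i`-th algebra on `L` into an action on `Xᵢ` alone
(`exists_distributing_isometry`). The structure theory of finite-dimensional star-algebras is not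
needed. Each algebra is a left module over itself, and the orthogonal projection `P` of all
operators onto it is a module map; the Kraus operators `P(|a⟩⟨b|)†`, normalized by an inverse square
root that commutes with everything relevant, intertwine the action of the algebra on `L` with its
action on a fresh copy of `L` (`exists_adapted_kraus`). Products of such Kraus operators, one for
each `i`, give `J`.

After `J`, the algebra of `A'ᵢ` is represented on `Aᵢ ⊗ Xᵢ`, and every representation of a full
matrix algebra is a multiple of the defining one. So there are isometries
`Aᵢ ⊗ Xᵢ → A'ᵢ ⊗ Yᵢ` that turn the representation into the action on `A'ᵢ`
(`splitIsometry`). The resulting circuit `W` satisfies `(a ⊗ 1) W U† = W U† (a ⊗ 1)` for all local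
operators `a`, so `W = (1 ⊗ Q) U` for an isometry `Q` on `F` (`exists_eq_one_kronecker`,
`exists_isometric_separation`), and a channel that inverts `Q` on the left completes the
decomposition (`exists_channel_leftInverse`, `exists_separable_circuit`).

Local dynamics follows. Consistent embeddings extend a transformation to a unitary channel, the
absence of superluminal influences makes that channel separable, and preparing its ancilla and
discarding its environment turns the separable circuit into a local one, with the decoherence maps
absorbed into the local transformations (`decomposesLocally_of_obtainedFrom`).
-/

set_option linter.unusedSectionVars false

noncomputable section

namespace QPT

open Matrix
open scoped Kronecker

/-! ### Calculus of linear maps between matrix algebras -/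

section Calculus

lemma linearMap_ext_single {ι : Type} [Fintype ι] [DecidableEq ι] {E : Type*} [AddCommMonoid E]
    [Module ℂ E] {f g : Op ι →ₗ[ℂ] E}
    (h : ∀ x y, f (single x y 1) = g (single x y 1)) : f = g := by
  refine Matrix.ext_linearMap ℂ fun x y => LinearMap.ext_ring ?_
  simpa using h x y

lemma linearMap_apply_entry {ι κ : Type} [Fintype ι] [DecidableEq ι] (T : Op ι →ₗ[ℂ] Op κ)
    (M : Op ι) (p q : κ) :
    T M p q = ∑ x, ∑ y, M x y * T (single x y 1) p q := by
  conv_lhs => rw [matrix_eq_sum_single M]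
  simp only [map_sum, Matrix.sum_apply]
  refine Finset.sum_congr rfl fun x _ => Finset.sum_congr rfl fun y _ => ?_
  have : single x y (M x y) = M x y • single x y (1 : ℂ) := by simp
  rw [this, map_smul, Matrix.smul_apply, smul_eq_mul]

@[simp]
lemma relabel_apply {ι κ : Type} (e : ι ≃ κ) (M : Op ι) (p q : κ) :
    relabel e M p q = M (e.symm p) (e.symm q) := rfl

lemma relabel_symm_comp {ι κ : Type} (e : ι ≃ κ) :
    relabel e.symm ∘ₗ relabel e = LinearMap.id := by
  ext M p q; simp

lemma relabel_single {ι κ : Type} [DecidableEq ι] [DecidableEq κ] (e : ι ≃ κ) (x y : ι) (c : ℂ) :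
    relabel e (single x y c) = single (e x) (e y) c := by
  ext p q
  simp [single_apply, Equiv.eq_symm_apply]

variable {ι κ ι' κ' ι'' κ'' : Type} [Fintype ι] [DecidableEq ι] [Fintype κ] [DecidableEq κ]
  [Fintype ι'] [DecidableEq ι'] [Fintype κ'] [DecidableEq κ']

lemma tensorMap_apply (S : Op ι →ₗ[ℂ] Op ι'') (T : Op κ →ₗ[ℂ] Op κ'') (M : Op (ι × κ))
    (p q : ι'' × κ'') :
    tensorMap S T M p q = ∑ x, ∑ y, M x y *
      (S (single x.1 y.1 1) p.1 q.1 * T (single x.2 y.2 1) p.2 q.2) := by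
  simp [tensorMap, Matrix.sum_apply, LinearMap.sum_apply]

lemma tensorMap_single (S : Op ι →ₗ[ℂ] Op ι'') (T : Op κ →ₗ[ℂ] Op κ'') (x y : ι × κ)
    (p q : ι'' × κ'') :
    tensorMap S T (single x y 1) p q =
      S (single x.1 y.1 1) p.1 q.1 * T (single x.2 y.2 1) p.2 q.2 := by
  rw [tensorMap_apply, Finset.sum_eq_single x, Finset.sum_eq_single y]
  · simp
  · intro b _ hb; simp [hb.symm]
  · simp
  · intro b _ hb; simp [hb.symm]
  · simp

lemma tensorMap_comp (S : Op ι →ₗ[ℂ] Op ι') (T : Op κ →ₗ[ℂ] Op κ')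
    (S' : Op ι' →ₗ[ℂ] Op ι'') (T' : Op κ' →ₗ[ℂ] Op κ'') :
    tensorMap S' T' ∘ₗ tensorMap S T = tensorMap (S' ∘ₗ S) (T' ∘ₗ T) := by
  refine linearMap_ext_single fun x y => ?_
  ext p q
  rw [LinearMap.comp_apply, tensorMap_apply, tensorMap_single]
  simp only [tensorMap_single, LinearMap.comp_apply]
  rw [linearMap_apply_entry S', linearMap_apply_entry T']
  simp only [Fintype.sum_prod_type, Finset.sum_mul_sum]
  refine Finset.sum_congr rfl fun a _ => ?_
  refine Finset.sum_congr rfl fun b _ => ?_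
  refine Finset.sum_congr rfl fun c _ => ?_
  refine Finset.sum_congr rfl fun d _ => ?_
  ring

lemma tensorMap_id_id :
    tensorMap (LinearMap.id : Op ι →ₗ[ℂ] _) (LinearMap.id : Op κ →ₗ[ℂ] _) = LinearMap.id := by
  refine linearMap_ext_single fun x y => ?_
  ext p q
  rw [tensorMap_single]
  simp only [LinearMap.id_apply, single_apply, Prod.ext_iff]
  split_ifs <;> simp_all

/-- The map `ρ ↦ K ρ K†`. -/
def conj {ι κ : Type} [Fintype ι] (K : Matrix κ ι ℂ) : Op ι →ₗ[ℂ] Op κ where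
  toFun ρ := K * ρ * Kᴴ
  map_add' ρ σ := by simp [Matrix.mul_add, Matrix.add_mul]
  map_smul' c ρ := by simp

lemma conj_apply (K : Matrix κ'' ι ℂ) (ρ : Op ι) : conj K ρ = K * ρ * Kᴴ := rfl

lemma conj_single (K : Matrix κ'' ι ℂ) (x y : ι) (p q : κ'') :
    conj K (single x y 1) p q = K p x * star (K q y) := by
  rw [conj_apply, Matrix.mul_apply, Finset.sum_eq_single y]
  · simp
  · intro b _ hb; simp [Matrix.mul_apply, hb.symm]
  · simp

lemma conj_comp_conj (K : Matrix κ ι ℂ) (K' : Matrix κ'' κ ℂ) :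
    conj K' ∘ₗ conj K = conj (K' * K) := by
  ext ρ : 1
  simp [conj_apply, Matrix.mul_assoc, conjTranspose_mul]

lemma conj_one : conj (1 : Op ι) = LinearMap.id := by
  ext ρ : 1
  simp [conj_apply]

lemma relabel_comp_conj (e : κ ≃ κ'') (K : Matrix κ ι ℂ) :
    relabel e ∘ₗ conj K = conj (K.submatrix e.symm id) := by
  refine linearMap_ext_single fun x y => ?_
  ext p q
  simp [conj_single]

lemma conj_comp_relabel (e : ι'' ≃ ι) [Fintype ι''] [DecidableEq ι''] (K : Matrix κ ι ℂ) :
    conj K ∘ₗ relabel e = conj (K.submatrix id e) := by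
  refine linearMap_ext_single fun x y => ?_
  ext p q
  simp [conj_single, relabel_single]

lemma tensorMap_conj (K : Matrix ι'' ι ℂ) (K' : Matrix κ'' κ ℂ) :
    tensorMap (conj K) (conj K') = conj (K ⊗ₖ K') := by
  refine linearMap_ext_single fun x y => ?_
  ext p q
  simp only [tensorMap_single, conj_single, kroneckerMap_apply, star_mul']
  ring

lemma tensorMap_sum_left {R : Type*} [Fintype R] (S : R → Op ι →ₗ[ℂ] Op ι'')
    (T : Op κ →ₗ[ℂ] Op κ'') :
    tensorMap (∑ r, S r) T = ∑ r, tensorMap (S r) T := by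
  refine linearMap_ext_single fun x y => ?_
  ext p q
  simp [tensorMap_single, LinearMap.sum_apply, Matrix.sum_apply, Finset.sum_mul]

lemma discardRight_apply (M : Op (ι × κ)) (a b : ι) :
    discardRight ι κ M a b = ∑ y, M (a, y) (b, y) := by
  revert M
  suffices h : Matrix.entryLinearMap ℂ ℂ a b ∘ₗ discardRight ι κ =
      ∑ y, Matrix.entryLinearMap ℂ ℂ (a, y) (b, y) by
    intro M
    simpa [LinearMap.sum_apply] using LinearMap.congr_fun h M
  refine linearMap_ext_single fun x y => ?_
  simp only [discardRight, LinearMap.comp_apply, LinearMap.sum_apply, entryLinearMap_apply,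
    relabel_apply, tensorMap_single, LinearMap.id_apply, single_apply, traceMap, Prod.ext_iff,
    LinearMap.smulRight_apply, traceLinearMap_apply, Matrix.smul_apply, Equiv.prodPUnit_symm_apply]
  by_cases h : x.1 = a ∧ y.1 = b
  · simp only [h, true_and, if_true, one_mul, and_self]
    by_cases h2 : x.2 = y.2
    · simp [h2]
    · rw [Matrix.trace_single_eq_of_ne _ _ _ h2, Finset.sum_eq_zero]
      · simp
      · intro i _
        rw [if_neg]
        rintro ⟨h3, h4⟩
        exact h2 (h3.trans h4.symm)
  · rw [if_neg h, Finset.sum_eq_zero]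
    · simp
    · intro i _
      rw [if_neg]
      tauto

end Calculus

section PiCalculus

variable {I : Type} [Fintype I] [DecidableEq I] {α β γ δ : I → Type}
  [∀ i, Fintype (α i)] [∀ i, DecidableEq (α i)]
  [∀ i, Fintype (β i)] [∀ i, DecidableEq (β i)]
  [∀ i, Fintype (γ i)] [∀ i, DecidableEq (γ i)]

lemma prod_sum_univ {R : Type*} [CommSemiring R] (f : ∀ i, α i → R) :
    ∏ i, ∑ x, f i x = ∑ x : ∀ i, α i, ∏ i, f i (x i) := by
  rw [Finset.prod_univ_sum, Fintype.piFinset_univ]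

lemma piTensorMap_apply (T : ∀ i, Op (α i) →ₗ[ℂ] Op (δ i)) (M : Op (∀ i, α i))
    (p q : ∀ i, δ i) :
    piTensorMap T M p q =
      ∑ x, ∑ y, M x y * ∏ i, T i (single (x i) (y i) 1) (p i) (q i) := by
  simp [piTensorMap, Matrix.sum_apply, LinearMap.sum_apply]

lemma piTensorMap_single (T : ∀ i, Op (α i) →ₗ[ℂ] Op (δ i)) (x y : ∀ i, α i) (p q : ∀ i, δ i) :
    piTensorMap T (single x y 1) p q = ∏ i, T i (single (x i) (y i) 1) (p i) (q i) := by
  rw [piTensorMap_apply, Finset.sum_eq_single x, Finset.sum_eq_single y]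
  · simp
  · intro b _ hb; simp [hb.symm]
  · simp
  · intro b _ hb; simp [hb.symm]
  · simp

lemma piTensorMap_comp (S : ∀ i, Op (α i) →ₗ[ℂ] Op (β i)) (T : ∀ i, Op (β i) →ₗ[ℂ] Op (δ i)) :
    piTensorMap T ∘ₗ piTensorMap S = piTensorMap fun i => T i ∘ₗ S i := by
  refine linearMap_ext_single fun x y => ?_
  ext p q
  rw [LinearMap.comp_apply, piTensorMap_apply, piTensorMap_single]
  simp only [piTensorMap_single, LinearMap.comp_apply, linearMap_apply_entry (T _) (S _ _),
    prod_sum_univ, ← Finset.prod_mul_distrib]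

lemma piTensorMap_id : piTensorMap (fun i => (LinearMap.id : Op (α i) →ₗ[ℂ] _)) = LinearMap.id := by
  refine linearMap_ext_single fun x y => ?_
  ext p q
  rw [piTensorMap_single]
  simp only [LinearMap.id_apply, single_apply, funext_iff]
  rw [Fintype.prod_boole]
  simp only [forall_and]

/-- The tensor product `⊗ᵢ Kᵢ` of a finite family of matrices. -/
def piKron (K : ∀ i, Matrix (β i) (α i) ℂ) : Matrix (∀ i, β i) (∀ i, α i) ℂ :=
  Matrix.of fun p x => ∏ i, K i (p i) (x i)

@[simp]
lemma piKron_apply (K : ∀ i, Matrix (β i) (α i) ℂ) (p : ∀ i, β i) (x : ∀ i, α i) :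
    piKron K p x = ∏ i, K i (p i) (x i) := rfl

lemma piTensorMap_conj (K : ∀ i, Matrix (β i) (α i) ℂ) :
    piTensorMap (fun i => conj (K i)) = conj (piKron K) := by
  refine linearMap_ext_single fun x y => ?_
  ext p q
  simp [piTensorMap_single, conj_single, Finset.prod_mul_distrib]

lemma piKron_mul (K : ∀ i, Matrix (β i) (α i) ℂ) (K' : ∀ i, Matrix (γ i) (β i) ℂ) :
    piKron K' * piKron K = piKron fun i => K' i * K i := by
  ext p x
  simp [Matrix.mul_apply, prod_sum_univ, Finset.prod_mul_distrib]

lemma piKron_conjTranspose (K : ∀ i, Matrix (β i) (α i) ℂ) :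
    (piKron K)ᴴ = piKron fun i => (K i)ᴴ := by
  ext p x
  simp

lemma piKron_one : piKron (fun i => (1 : Op (α i))) = 1 := by
  ext p x
  simp only [piKron_apply, one_apply, funext_iff]
  rw [Fintype.prod_boole]

lemma piKron_update_one (i : I) (M : Op (α i)) (p x : ∀ i, α i) :
    piKron (Function.update (fun _ => 1) i M) p x =
      if ∀ k, k ≠ i → p k = x k then M (p i) (x i) else 0 := by
  rw [piKron_apply, ← Finset.mul_prod_erase _ _ (Finset.mem_univ i)]
  have h : ∏ k ∈ Finset.univ.erase i,
      (Function.update (fun _ => 1) i M : ∀ k, Op (α k)) k (p k) (x k) =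
      ∏ k ∈ Finset.univ.erase i, if p k = x k then 1 else 0 := by
    refine Finset.prod_congr rfl fun k hk => ?_
    rw [Function.update_of_ne (Finset.ne_of_mem_erase hk), one_apply]
  rw [h, Finset.prod_boole]
  simp

lemma piTensorMap_tensorMap_comp_relabel (S : ∀ i, Op (α i) →ₗ[ℂ] Op (γ i))
    (T : ∀ i, Op (β i) →ₗ[ℂ] Op (δ i)) :
    piTensorMap (α := fun i => α i × β i) (β := fun i => γ i × δ i)
        (fun i => tensorMap (S i) (T i)) ∘ₗ
      relabel (Equiv.arrowProdEquivProdArrow I α β).symm =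
    relabel (Equiv.arrowProdEquivProdArrow I γ δ).symm ∘ₗ
      tensorMap (piTensorMap S) (piTensorMap T) := by
  refine linearMap_ext_single fun x y => ?_
  ext p q
  simp only [LinearMap.comp_apply, relabel_single, piTensorMap_single, tensorMap_single,
    relabel_apply, Finset.prod_mul_distrib]
  rfl

lemma discardRight_comp_relabel_piTensorMap
    (T : ∀ i, Op (α i) →ₗ[ℂ] Op (β i × γ i)) :
    discardRight (∀ i, β i) (∀ i, γ i) ∘ₗ relabel (Equiv.arrowProdEquivProdArrow I β γ) ∘ₗ
      piTensorMap (β := fun i => β i × γ i) T =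
    piTensorMap fun i => discardRight (β i) (γ i) ∘ₗ T i := by
  refine linearMap_ext_single fun x y => ?_
  ext p q
  simp only [LinearMap.comp_apply, piTensorMap_single, discardRight_apply, relabel_apply,
    prod_sum_univ]
  rfl

end PiCalculus

/-! ### Complete positivity and superselection sectors -/

section CompletelyPositive

variable {ι κ ι' : Type} [Fintype ι] [DecidableEq ι] [Fintype κ] [DecidableEq κ]
  [Fintype ι']

lemma IsCP.comp {S : Op ι →ₗ[ℂ] Op κ} {T : Op κ →ₗ[ℂ] Op ι'} (hT : IsCP T) (hS : IsCP S) :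
    IsCP (T ∘ₗ S) := by
  intro k M hM
  have := hT k _ (hS k M hM)
  rwa [← LinearMap.comp_apply, tensorMap_comp, LinearMap.id_comp] at this

lemma isCP_conj (K : Matrix ι' ι ℂ) : IsCP (conj K) := by
  intro k M hM
  rw [← conj_one, tensorMap_conj, conj_apply]
  exact hM.mul_mul_conjTranspose_same _

lemma isCP_sum {R : Type*} [Fintype R] {T : R → Op ι →ₗ[ℂ] Op κ} (hT : ∀ r, IsCP (T r)) :
    IsCP (∑ r, T r) := by
  intro k M hM
  rw [tensorMap_sum_left, LinearMap.sum_apply]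
  exact posSemidef_sum _ fun r _ => hT r k M hM

lemma isCP_discardRight : IsCP (discardRight ι κ) := by
  have : discardRight ι κ =
      ∑ y : κ, conj (Matrix.of fun (a : ι) (p : ι × κ) => if p = (a, y) then (1 : ℂ) else 0) := by
    refine linearMap_ext_single fun x y => ?_
    ext a b
    simp only [discardRight_apply, LinearMap.sum_apply, Matrix.sum_apply, conj_single, of_apply,
      single_apply]
    refine Finset.sum_congr rfl fun c _ => ?_
    split_ifs <;> simp_all
  rw [this]
  exact isCP_sum fun _ => isCP_conj _

open Classical in
lemma System.isCP_decohere (A : System) : IsCP A.decohere := by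
  let _ : Fintype (Quotient A.sectors) := Fintype.ofFinite _
  have : A.decohere = ∑ c : Quotient A.sectors,
      conj (Matrix.diagonal fun a : A.Basis =>
        if Quotient.mk A.sectors a = c then (1 : ℂ) else 0) := by
    refine LinearMap.ext fun M => ?_
    ext a b
    simp only [System.decohere, LinearMap.coe_mk, AddHom.coe_mk, of_apply, LinearMap.sum_apply,
      Matrix.sum_apply, conj_apply, diagonal_conjTranspose, mul_diagonal, diagonal_mul,
      Pi.star_apply]
    rw [Finset.sum_eq_single (Quotient.mk A.sectors a)]
    · by_cases h : A.sectors a b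
      · have h' := Quotient.sound (s := A.sectors) h
        simp [h, h']
      · have h' : ¬ Quotient.mk A.sectors b = Quotient.mk A.sectors a := fun h' =>
          h (Quotient.exact h'.symm)
        simp [h, h']
    · intro c _ hc
      simp [hc.symm]
    · simp
  rw [this]
  exact isCP_sum fun _ => isCP_conj _

lemma trace_discardRight (M : Op (ι × κ)) : (discardRight ι κ M).trace = M.trace := by
  simp [Matrix.trace, discardRight_apply, Fintype.sum_prod_type]

lemma trace_conj (K : Matrix κ ι ℂ) (M : Op ι) : (conj K M).trace = (Kᴴ * K * M).trace := by
  rw [conj_apply, Matrix.trace_mul_comm, ← Matrix.mul_assoc]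

lemma trace_conj_of_isometry {K : Matrix κ ι ℂ} (hK : Kᴴ * K = 1) (M : Op ι) :
    (conj K M).trace = M.trace := by
  rw [trace_conj, hK, Matrix.one_mul]

lemma discardRight_comp_tensorMap_id {R : Op κ →ₗ[ℂ] Op ι'} [DecidableEq ι']
    (hR : ∀ ρ, (R ρ).trace = ρ.trace) :
    discardRight ι ι' ∘ₗ tensorMap LinearMap.id R = discardRight ι κ := by
  refine linearMap_ext_single fun x y => ?_
  ext a b
  have h := hR (single x.2 y.2 1)
  simp only [Matrix.trace, Matrix.diag] at h
  simp only [LinearMap.comp_apply, discardRight_apply, tensorMap_single, LinearMap.id_apply,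
    ← Finset.mul_sum, h]
  rw [Finset.mul_sum]
  refine Finset.sum_congr rfl fun c _ => ?_
  simp only [single_apply, Prod.ext_iff]
  split_ifs <;> simp_all

end CompletelyPositive

section Pinching

open Classical in
/-- The projection onto the matrices that are block-diagonal for a partition of the basis;
`System.decohere` is, by definition, this map for the partition into sectors. -/
def pinch {ι : Type} (r : Setoid ι) : Op ι →ₗ[ℂ] Op ι where
  toFun ρ := Matrix.of fun a b => if r a b then ρ a b else 0
  map_add' ρ σ := by
    ext a b
    by_cases h : r a b <;> simp [h]
  map_smul' c ρ := by
    ext a b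
    by_cases h : r a b <;> simp [h]

open Classical in
lemma pinch_apply {ι : Type} (r : Setoid ι) (M : Op ι) (a b : ι) :
    pinch r M a b = if r a b then M a b else 0 := rfl

lemma pinch_prod {ι κ : Type} [Fintype ι] [DecidableEq ι] [Fintype κ] [DecidableEq κ]
    (r : Setoid ι) (s : Setoid κ) : pinch (r.prod s) = tensorMap (pinch r) (pinch s) := by
  refine linearMap_ext_single fun x y => ?_
  ext p q
  have h : r.prod s p q ↔ r p.1 q.1 ∧ s p.2 q.2 := Iff.rfl
  simp only [tensorMap_single, pinch_apply, h, single_apply, Prod.ext_iff]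
  split_ifs <;> simp_all

lemma pinch_pi {I : Type} [Fintype I] [DecidableEq I] {α : I → Type} [∀ i, Fintype (α i)]
    [∀ i, DecidableEq (α i)] (r : ∀ i, Setoid (α i)) :
    pinch (@piSetoid I α r) = piTensorMap fun i => pinch (r i) := by
  classical
  refine linearMap_ext_single fun x y => ?_
  ext p q
  have h : @piSetoid I α r p q ↔ ∀ i, r i (p i) (q i) := Iff.rfl
  simp only [piTensorMap_single, pinch_apply, h, single_apply, ← ite_and]
  rw [Fintype.prod_boole]
  simp only [funext_iff, forall_and]

end Pinching

namespace System

open Classical in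
lemma decohere_apply (A : System) (M : Op A.Basis) (a b : A.Basis) :
    A.decohere M a b = if A.sectors a b then M a b else 0 := rfl

lemma decohere_comp_decohere (A : System) : A.decohere ∘ₗ A.decohere = A.decohere := by
  classical
  ext M a b
  by_cases h : A.sectors a b <;> simp [decohere_apply, h]

lemma trace_decohere (A : System) (M : Op A.Basis) : (A.decohere M).trace = M.trace := by
  classical
  simp [Matrix.trace, decohere_apply]

lemma IsQuantum.decohere {A : System} (h : A.IsQuantum) : A.decohere = LinearMap.id := by
  classical
  ext M a b
  have : A.sectors a b := by rw [h]; trivial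
  simp [decohere_apply, this]

lemma decohere_prod (A B : System) :
    (A.prod B).decohere = tensorMap A.decohere B.decohere :=
  pinch_prod A.sectors B.sectors

lemma decohere_pi {I : Type} [Fintype I] [DecidableEq I] (A : I → System) :
    (System.pi A).decohere = piTensorMap fun i => (A i).decohere :=
  pinch_pi fun i => (A i).sectors

lemma isQuantum_of_pi {I : Type} [Fintype I] [DecidableEq I] {A : I → System}
    (h : (System.pi A).IsQuantum) (i : I) : (A i).IsQuantum := by
  refine eq_top_iff.2 fun a b _ => ?_
  have h' : (System.pi A).sectors
      (Function.update (fun i => Classical.arbitrary (A i).Basis) i a)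
      (Function.update (fun i => Classical.arbitrary (A i).Basis) i b) := by
    rw [h]; trivial
  simpa using (show ∀ k, (A k).sectors _ _ from h') i

lemma IsQuantum.pi {I : Type} [Fintype I] [DecidableEq I] {A : I → System}
    (h : ∀ i, (A i).IsQuantum) : (System.pi A).IsQuantum :=
  eq_top_iff.2 fun a b _ i => by
    change (A i).sectors (a i) (b i)
    rw [h i]; trivial

lemma IsQuantum.prod {A B : System} (hA : A.IsQuantum) (hB : B.IsQuantum) :
    (A.prod B).IsQuantum :=
  eq_top_iff.2 fun a b _ => ⟨by rw [hA]; trivial, by rw [hB]; trivial⟩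

/-- The quantum system with a given basis. -/
def quantum (ι : Type) [Fintype ι] [DecidableEq ι] [Nonempty ι] : System where
  Basis := ι
  sectors := ⊤

lemma isQuantum_quantum (ι : Type) [Fintype ι] [DecidableEq ι] [Nonempty ι] :
    (quantum ι).IsQuantum := rfl

end System

/-- Between quantum systems, every completely positive map is a transformation. -/
def Transformation.ofCP {A B : System} (hA : A.IsQuantum) (hB : B.IsQuantum)
    (T : Op A.Basis →ₗ[ℂ] Op B.Basis) (hT : IsCP T) : Transformation A B where
  map := T
  cp := hT
  map_decohere := by rw [hA.decohere, LinearMap.comp_id]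
  decohere_map := by rw [hB.decohere, LinearMap.id_comp]

/-! ### Kraus families adapted to a commuting pair of matrix algebras -/

section AdaptedKraus

variable {l : Type} [Fintype l] [DecidableEq l]

/-- The orthogonal projection onto `W` for the Hilbert–Schmidt inner product. It commutes with left
multiplication by `a` because both `W` and its orthogonal complement are stable under it. -/
lemma exists_projection_commuting_with_left_mul (W : Submodule ℂ (Op l)) :
    ∃ P : Op l →ₗ[ℂ] Op l, (∀ M, P M ∈ W) ∧ (∀ M ∈ W, P M = M) ∧
      ∀ a : Op l, (∀ w ∈ W, a * w ∈ W) → (∀ w ∈ W, aᴴ * w ∈ W) →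
        ∀ M, P (a * M) = a * P M := by
  let e : Op l ≃ₗ[ℂ] EuclideanSpace ℂ (l × l) :=
    (LinearEquiv.curry ℂ ℂ l l).symm.trans (WithLp.linearEquiv 2 ℂ (l × l → ℂ)).symm
  have he : ∀ A B : Op l, inner ℂ (e A) (e B) = (Aᴴ * B).trace := by
    intro A B
    simp only [PiLp.inner_apply, Fintype.sum_prod_type, Matrix.trace, Matrix.diag, Matrix.mul_apply]
    rw [Finset.sum_comm]
    refine Finset.sum_congr rfl fun i _ => Finset.sum_congr rfl fun j _ => ?_
    exact mul_comm _ _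
  let W' := W.map e.toLinearMap
  refine ⟨e.symm.toLinearMap ∘ₗ W'.starProjection.toLinearMap ∘ₗ e.toLinearMap, ?_, ?_, ?_⟩
  · intro M
    obtain ⟨w, hw, h⟩ := W'.starProjection_apply_mem (e M)
    have h' : W'.starProjection (e M) = e w := h.symm
    simpa [h'] using hw
  · intro M hM
    have : W'.starProjection (e M) = e M :=
      Submodule.starProjection_eq_self_iff.2 ⟨M, hM, rfl⟩
    simp [this]
  · intro a ha ha' M
    obtain ⟨w, hw, h⟩ := W'.starProjection_apply_mem (e M)
    have h' : W'.starProjection (e M) = e w := h.symm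
    have : W'.starProjection (e (a * M)) = e (a * w) := by
      refine Submodule.eq_starProjection_of_mem_of_inner_eq_zero ⟨_, ha w hw, rfl⟩ ?_
      rintro _ ⟨v, hv, rfl⟩
      have h2 := Submodule.starProjection_inner_eq_zero (K := W') (e M) (e (aᴴ * v))
        ⟨_, ha' v hv, rfl⟩
      rw [h', ← map_sub, he] at h2
      change inner ℂ (e (a * M) - e (a * w)) (e v) = 0
      rw [← map_sub, he, ← Matrix.mul_sub, conjTranspose_mul, Matrix.mul_assoc]
      exact h2
    simp [this, h']

/-- A positive definite matrix has an inverse square root, lying in its bicommutant. -/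
lemma exists_inverse_sqrt {G : Op l} (hG : G.PosDef) :
    ∃ H : Op l, Hᴴ = H ∧ H * G * H = 1 ∧ ∀ b, Commute G b → Commute H b := by
  have hsa : IsSelfAdjoint G := hG.1
  refine ⟨cfc (fun x : ℝ => (√x)⁻¹) G, ?_, ?_, fun b hb => hsa.commute_cfc hb _⟩
  · exact (cfc_predicate (fun x : ℝ => (√x)⁻¹) G : IsSelfAdjoint _)
  · have hpos : ∀ x ∈ spectrum ℝ G, 0 < x := by
      intro x hx
      rw [hG.1.spectrum_real_eq_range_eigenvalues] at hx
      obtain ⟨i, rfl⟩ := hx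
      exact hG.eigenvalues_pos i
    have hc : ∀ f : ℝ → ℝ, ContinuousOn f (spectrum ℝ G) := fun f =>
      (Matrix.finite_real_spectrum (A := G)).continuousOn f
    nth_rewrite 2 [← cfc_id ℝ G]
    rw [← cfc_mul _ _ G (hc _) (hc _), ← cfc_mul _ _ G (hc _) (hc _), ← cfc_one ℝ G]
    refine cfc_congr fun x hx => ?_
    have := hpos x hx
    have h2 : √x ≠ 0 := (Real.sqrt_pos.2 this).ne'
    simp only [id, Pi.one_apply]
    field_simp
    rw [Real.sq_sqrt this.le]

/-- For a star-closed set `S` of operators on `ℂ^l` there is an isometry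
`ℂ^l → (ℂ^l ⊗ ℂ^l) ⊗ ℂ^l`, written as a family of Kraus operators `Q m`, whose components lie in
the bicommutant of `S` and which intertwines every `s ∈ S` with `s` acting on the first factor
`ℂ^l`. It is obtained from the projection onto the bicommutant, viewed as a left module, by
normalization. -/
lemma exists_adapted_kraus {S : Set (Op l)} (hS : ∀ s ∈ S, sᴴ ∈ S) :
    ∃ Q : l × l → Op l,
      (∀ m, Q m ∈ Set.centralizer (Set.centralizer S)) ∧
      ∑ m, (Q m)ᴴ * Q m = 1 ∧
      ∀ s ∈ S, ∀ a b, Q (a, b) * s = ∑ a', s a a' • Q (a', b) := by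
  let W : Submodule ℂ (Op l) :=
    (Subalgebra.centralizer ℂ (Set.centralizer S)).toSubmodule
  have hstar1 : ∀ b ∈ Set.centralizer S, bᴴ ∈ Set.centralizer S := by
    intro b hb s hs
    have := congrArg conjTranspose (hb sᴴ (hS s hs))
    simpa using this.symm
  have hstar2 : ∀ b ∈ Set.centralizer (Set.centralizer S),
      bᴴ ∈ Set.centralizer (Set.centralizer S) := by
    intro b hb s hs
    have := congrArg conjTranspose (hb sᴴ (hstar1 s hs))
    simpa using this.symm
  have hSW : ∀ s ∈ S, s ∈ W := fun s hs => Set.subset_centralizer_centralizer hs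
  have hmul : ∀ a ∈ W, ∀ w ∈ W, a * w ∈ W := fun a ha w hw => Set.mul_mem_centralizer ha hw
  obtain ⟨P, hPW, hPid, hP⟩ := exists_projection_commuting_with_left_mul W
  replace hP : ∀ s ∈ S, ∀ M, P (s * M) = s * P M := fun s hs M =>
    hP s (hmul s (hSW s hs)) (hmul _ (hSW _ (hS s hs))) M
  let R : l × l → Op l := fun m => (P (single m.1 m.2 1))ᴴ
  have hRmem : ∀ m, R m ∈ Set.centralizer (Set.centralizer S) := fun m => hstar2 _ (hPW _)
  have hsE : ∀ (s : Op l) (a b : l), s * single a b 1 = ∑ a', s a' a • single a' b (1 : ℂ) := by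
    intro s a b
    ext i j
    simp [Matrix.sum_apply, single_apply, Matrix.mul_apply, and_comm, ite_and]
  have hRs : ∀ s ∈ S, ∀ a b, R (a, b) * s = ∑ a', s a a' • R (a', b) := by
    intro s hs a b
    have h1 := congrArg conjTranspose (hP sᴴ (hS s hs) (single a b 1))
    rw [hsE, conjTranspose_mul, conjTranspose_conjTranspose] at h1
    rw [show R (a, b) * s = (P (single a b 1))ᴴ * s from rfl, ← h1, map_sum, conjTranspose_sum]
    refine Finset.sum_congr rfl fun a' _ => ?_
    rw [map_smul, conjTranspose_smul, conjTranspose_apply, star_star]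
  let G : Op l := ∑ m, (R m)ᴴ * R m
  have hGW : ∀ b ∈ Set.centralizer S, Commute G b := by
    intro b hb
    refine Commute.sum_left _ _ _ fun m _ => ?_
    exact Commute.mul_left (hstar2 _ (hRmem m) b hb).symm (hRmem m b hb).symm
  have hGS : ∀ s ∈ S, Commute G s := by
    intro s hs
    have h1 : G * s = ∑ b, ∑ a, ∑ a', s a a' • ((R (a, b))ᴴ * R (a', b)) := by
      simp only [G, Fintype.sum_prod_type, Finset.sum_mul]
      rw [Finset.sum_comm]
      refine Finset.sum_congr rfl fun b _ => Finset.sum_congr rfl fun a _ => ?_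
      rw [Matrix.mul_assoc, hRs s hs, Finset.mul_sum]
      simp
    have h2 : s * G = ∑ b, ∑ a, ∑ a', s a' a • ((R (a', b))ᴴ * R (a, b)) := by
      simp only [G, Fintype.sum_prod_type, Finset.mul_sum]
      rw [Finset.sum_comm]
      refine Finset.sum_congr rfl fun b _ => Finset.sum_congr rfl fun a _ => ?_
      have h3 := congrArg conjTranspose (hRs _ (hS s hs) a b)
      rw [conjTranspose_mul, conjTranspose_conjTranspose] at h3
      rw [← Matrix.mul_assoc, h3, conjTranspose_sum, Finset.sum_mul]
      simp
    change G * s = s * G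
    rw [h1, h2]
    refine Finset.sum_congr rfl fun b _ => ?_
    rw [Finset.sum_comm]
  have hGpos : G.PosDef := by
    refine PosDef.of_dotProduct_mulVec_pos ?_ ?_
    · simp [G, IsHermitian, conjTranspose_sum]
    · intro v hv
      have hsum : star v ⬝ᵥ (G *ᵥ v) = ∑ m, star (R m *ᵥ v) ⬝ᵥ (R m *ᵥ v) := by
        simp only [G, Matrix.sum_mulVec, dotProduct_sum, ← Matrix.mulVec_mulVec, star_mulVec,
          ← dotProduct_mulVec]
      rw [hsum]
      have hnn : ∀ m ∈ Finset.univ, 0 ≤ star (R m *ᵥ v) ⬝ᵥ (R m *ᵥ v) := fun m _ =>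
        dotProduct_star_self_nonneg _
      refine lt_of_le_of_ne (Finset.sum_nonneg hnn) fun h0 => hv ?_
      have hz : ∀ m, R m *ᵥ v = 0 := fun m =>
        dotProduct_star_self_eq_zero.1 ((Finset.sum_eq_zero_iff_of_nonneg hnn).1 h0.symm m
          (Finset.mem_univ m))
      -- The identity lies in the bicommutant, so `P` fixes it and it is a sum of members of `R`;
      -- hence the `R m` have no common kernel.
      have h1 : (1 : Op l) = ∑ a, R (a, a) := by
        have h2 : P 1 = 1 := hPid 1 Set.one_mem_centralizer
        have h3 : (1 : Op l) = ∑ a, single a a (1 : ℂ) := by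
          ext i j
          simp [Matrix.sum_apply, single_apply, one_apply, ite_and]
        calc (1 : Op l) = (P 1)ᴴ := by rw [h2, conjTranspose_one]
          _ = _ := by rw [h3, map_sum, conjTranspose_sum]
      calc v = (1 : Op l) *ᵥ v := by simp
        _ = 0 := by rw [h1, Matrix.sum_mulVec]; simp [hz]
  obtain ⟨H, hH, hHG, hHc⟩ := exists_inverse_sqrt hGpos
  refine ⟨fun m => R m * H, fun m => ?_, ?_, ?_⟩
  · refine Set.mul_mem_centralizer (hRmem m) fun b hb => ?_
    exact (hHc b (hGW b hb)).symm
  · have : ∀ m, (R m * H)ᴴ * (R m * H) = H * ((R m)ᴴ * R m) * H := fun m => by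
      simp only [conjTranspose_mul, hH, Matrix.mul_assoc]
    simp only [this, ← Finset.sum_mul, ← Finset.mul_sum]
    exact hHG
  · intro s hs a b
    dsimp only
    rw [Matrix.mul_assoc, (hHc s (hGS s hs)).eq, ← Matrix.mul_assoc, hRs s hs, Finset.sum_mul]
    simp

end AdaptedKraus

/-! ### Operators acting on one factor of a tensor product -/

section Local

/-- A function of finite families that is unaffected by changing a single value is constant. -/
lemma eq_of_update_invariant {I : Type} [Fintype I] [DecidableEq I] {α : I → Type} {E : Type*}
    {f : (∀ i, α i) → E} (hf : ∀ i x q, f (Function.update x i q) = f x) (x y : ∀ i, α i) :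
    f x = f y := by
  have key : ∀ s : Finset I, f (s.piecewise x y) = f y := by
    intro s
    induction s using Finset.induction with
    | empty => simp
    | insert j s _ ih => rw [Finset.piecewise_insert, hf j, ih]
  rw [← key Finset.univ, Finset.piecewise_univ]

variable {I : Type} [Fintype I] [DecidableEq I] {α : I → Type}
  [∀ i, Fintype (α i)] [∀ i, DecidableEq (α i)] {L : Type} [Fintype L] [DecidableEq L]

/-- The operator `M` on `ℂ^(α i) ⊗ ℂ^L`, acting on `(⊗ₖ ℂ^(α k)) ⊗ ℂ^L`. -/
def lift (i : I) (M : Op (α i × L)) : Op ((∀ i, α i) × L) :=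
  Matrix.of fun x y => if ∀ k, k ≠ i → x.1 k = y.1 k then M (x.1 i, x.2) (y.1 i, y.2) else 0

lemma lift_apply (i : I) (M : Op (α i × L)) (x y : (∀ i, α i) × L) :
    lift i M x y = if ∀ k, k ≠ i → x.1 k = y.1 k then M (x.1 i, x.2) (y.1 i, y.2) else 0 := rfl

/-- Splitting off the factors other than `i`. -/
def splitEquiv (α : I → Type) (L : Type) (i : I) :
    ((∀ i, α i) × L) ≃ (α i × L) × (∀ k : {k // k ≠ i}, α k) :=
  ((Equiv.piSplitAt i α).prodCongr (Equiv.refl L)).trans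
    ((Equiv.prodAssoc _ _ _).trans
      (((Equiv.refl _).prodCongr (Equiv.prodComm _ _)).trans (Equiv.prodAssoc _ _ _).symm))

lemma lift_eq_submatrix (i : I) (M : Op (α i × L)) :
    lift i M = (M ⊗ₖ (1 : Op (∀ k : {k // k ≠ i}, α k))).submatrix
      (splitEquiv α L i) (splitEquiv α L i) := by
  ext x y
  simp [lift_apply, splitEquiv, one_apply, funext_iff]

lemma lift_mul (i : I) (M N : Op (α i × L)) : lift i (M * N) = lift i M * lift i N := by
  simp only [lift_eq_submatrix, submatrix_mul_equiv, ← mul_kronecker_mul, Matrix.one_mul]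

lemma lift_one (i : I) : lift i (1 : Op (α i × L)) = 1 := by
  simp [lift_eq_submatrix]

lemma lift_conjTranspose (i : I) (M : Op (α i × L)) : lift i Mᴴ = (lift i M)ᴴ := by
  simp [lift_eq_submatrix, conjTranspose_submatrix, conjTranspose_kronecker]

lemma lift_injective [∀ i, Nonempty (α i)] (i : I) :
    Function.Injective (lift i : Op (α i × L) → _) := by
  intro M N h
  ext ⟨p, l⟩ ⟨q, m⟩
  have := congrFun (congrFun h
    (Function.update (fun k => Classical.arbitrary (α k)) i p, l))
    (Function.update (fun k => Classical.arbitrary (α k)) i q, m)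
  rw [lift_apply, lift_apply, if_pos (by intro k hk; simp [hk]),
    if_pos (by intro k hk; simp [hk])] at this
  simpa using this

/-- The `(p, q)` block of an operator on `ℂ^ι ⊗ ℂ^L`. -/
def slice {ι L : Type} (M : Op (ι × L)) (p q : ι) : Op L :=
  Matrix.of fun l m => M (p, l) (q, m)

lemma slice_apply {ι L : Type} (M : Op (ι × L)) (p q : ι) (l m : L) :
    slice M p q l m = M (p, l) (q, m) := rfl

lemma slice_lift (i : I) (M : Op (α i × L)) (x y : ∀ i, α i) :
    slice (lift i M) x y = if ∀ k, k ≠ i → x k = y k then slice M (x i) (y i) else 0 := by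
  ext l m
  rw [slice_apply, lift_apply]
  split_ifs <;> rfl

lemma slice_mul {ι : Type} [Fintype ι] (M N : Op (ι × L)) (p q : ι) :
    slice (M * N) p q = ∑ r, slice M p r * slice N r q := by
  ext l m
  simp [slice_apply, Matrix.mul_apply, Matrix.sum_apply, Fintype.sum_prod_type]

lemma slice_lift_mul_lift [∀ i, Nonempty (α i)] {i j : I} (hij : i ≠ j) (M : Op (α i × L))
    (N : Op (α j × L)) (p q : α i) (r t : α j) :
    slice (lift i M * lift j N)
      (Function.update (Function.update (fun k => Classical.arbitrary (α k)) i p) j r)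
      (Function.update (Function.update (fun k => Classical.arbitrary (α k)) i q) j t) =
    slice M p q * slice N r t := by
  rw [slice_mul, Finset.sum_eq_single
    (Function.update (Function.update (fun k => Classical.arbitrary (α k)) i q) j r)]
  · rw [slice_lift, slice_lift, if_pos, if_pos]
    · simp [hij]
    · intro k hk
      simp [hk]
    · intro k hk
      by_cases h : k = j
      · subst h; simp
      · simp [h, hk]
  · intro z _ hz
    rw [slice_lift, slice_lift]
    by_cases h1 : ∀ k, k ≠ i →
        Function.update (Function.update (fun k => Classical.arbitrary (α k)) i p) j r k = z k
    · refine mul_eq_zero_of_right _ (if_neg fun h2 => ?_)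
      refine hz (funext fun k => ?_)
      by_cases hk : k = i
      · subst hk
        rw [h2 k hij]
        simp [hij]
      · rw [← h1 k hk]
        by_cases hkj : k = j
        · subst hkj; simp
        · simp [hkj, hk]
    · rw [if_neg h1, zero_mul]
  · simp

/-- If operators on `Aᵢ ⊗ L` and on `Aⱼ ⊗ L` commute, then so do their components on `L`. -/
lemma commute_slice [∀ i, Nonempty (α i)] {i j : I} (hij : i ≠ j) {M : Op (α i × L)}
    {N : Op (α j × L)} (h : Commute (lift i M) (lift j N)) (p q : α i) (r t : α j) :
    Commute (slice M p q) (slice N r t) := by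
  have h1 := slice_lift_mul_lift hij M N p q r t
  have h2 := slice_lift_mul_lift hij.symm N M r t p q
  rw [h.eq] at h1
  rw [Function.update_comm hij, Function.update_comm hij] at h1
  exact h1.symm.trans h2

lemma lift_kronecker_one_mul_apply {κ : Type} (i : I) (a : Op (α i))
    (C : Matrix ((∀ i, α i) × L) κ ℂ) (x : (∀ i, α i) × L) (w : κ) :
    (lift i (a ⊗ₖ (1 : Op L)) * C) x w =
      ∑ p, a (x.1 i) p * C (Function.update x.1 i p, x.2) w := by
  rw [Matrix.mul_apply]
  symm
  refine Finset.sum_of_injOn (fun p => (Function.update x.1 i p, x.2)) ?_ ?_ ?_ ?_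
  · intro p _ q _ h
    exact Function.update_injective x.1 i (Prod.ext_iff.1 h).1
  · simp
  · rintro ⟨y, m⟩ _ hy
    rw [lift_apply]
    by_cases h : ∀ k, k ≠ i → x.1 k = y k
    · have hm : x.2 ≠ m := by
        rintro rfl
        refine hy ⟨y i, by simp, ?_⟩
        refine Prod.ext (funext fun k => ?_) rfl
        by_cases hk : k = i
        · subst hk; simp
        · simp [hk, h k hk]
      simp [one_apply, hm]
    · simp [h]
  · intro p _
    rw [lift_apply, if_pos]
    · simp
    · intro k hk
      simp [hk]

lemma mul_lift_kronecker_one_apply {κ : Type} (i : I) (a : Op (α i))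
    (C : Matrix κ ((∀ i, α i) × L) ℂ) (x : (∀ i, α i) × L) (w : κ) :
    (C * lift i (a ⊗ₖ (1 : Op L))) w x =
      ∑ p, C w (Function.update x.1 i p, x.2) * a p (x.1 i) := by
  have h := lift_kronecker_one_mul_apply i aᴴ Cᴴ x w
  rw [← conjTranspose_one, ← conjTranspose_kronecker, lift_conjTranspose, ← conjTranspose_mul,
    conjTranspose_apply] at h
  have h' := congrArg star h
  rw [star_star] at h'
  refine h'.trans ?_
  simp [mul_comm]

/-- A matrix intertwining the actions of all local operators on `⊗ᵢ ℂ^(α i)` is of the form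
`1 ⊗ Q`. -/
lemma exists_eq_one_kronecker [∀ i, Nonempty (α i)] {Y : Type} [Fintype Y] [DecidableEq Y]
    (C : Matrix ((∀ i, α i) × Y) ((∀ i, α i) × L) ℂ)
    (hC : ∀ i (a : Op (α i)), lift i (a ⊗ₖ (1 : Op Y)) * C = C * lift i (a ⊗ₖ (1 : Op L))) :
    ∃ Q : Matrix Y L ℂ, C = (1 : Op (∀ i, α i)) ⊗ₖ Q := by
  -- The intertwining property for the matrix unit `|p⟩⟨q|`, entry by entry: `p = q` gives vanishing
  -- off the diagonal, and `p ≠ q` compares different diagonal positions.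
  have key : ∀ i (p q : α i) (x : (∀ i, α i) × Y) (w : (∀ i, α i) × L),
      (if x.1 i = p then C (Function.update x.1 i q, x.2) w else 0) =
      if w.1 i = q then C x (Function.update w.1 i p, w.2) else 0 := by
    intro i p q x w
    have h := congrFun (congrFun (hC i (single p q 1)) x) w
    rw [lift_kronecker_one_mul_apply, mul_lift_kronecker_one_apply] at h
    simpa [single_apply, eq_comm, ite_and] using h
  have hoff : ∀ x w, x.1 ≠ w.1 → C x w = 0 := by
    intro x w hxw
    obtain ⟨i, hi⟩ := Function.ne_iff.1 hxw
    have h := key i (x.1 i) (x.1 i) x w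
    simpa [hi.symm] using h
  refine ⟨Matrix.of fun y l => C (fun i => Classical.arbitrary (α i), y)
    (fun i => Classical.arbitrary (α i), l), ?_⟩
  ext ⟨x, y⟩ ⟨w, l⟩
  rw [kronecker_apply, one_apply]
  split_ifs with h
  · subst h
    rw [one_mul, of_apply]
    refine eq_of_update_invariant (f := fun z => C (z, y) (z, l)) ?_ _ _
    intro i z q
    have h := key i (z i) q (z, y) (Function.update z i q, l)
    simpa using h
  · rw [zero_mul]
    exact hoff _ _ h

/-- An operator on `(⊗ₖ ℂ^(α k)) ⊗ ℂ^L` that vanishes off the diagonal in all factors but the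
`j`-th, and has entries independent of the diagonal position there, acts on
`ℂ^(α j) ⊗ ℂ^L` only. -/
lemma exists_eq_lift [∀ i, Nonempty (α i)] (j : I) (N : Op ((∀ i, α i) × L))
    (hoff : ∀ i, i ≠ j → ∀ x y : (∀ i, α i) × L, x.1 i ≠ y.1 i → N x y = 0)
    (hdiag : ∀ i, i ≠ j → ∀ x y : (∀ i, α i) × L, x.1 i = y.1 i → ∀ q,
      N (Function.update x.1 i q, x.2) (Function.update y.1 i q, y.2) = N x y) :
    ∃ M, N = lift j M := by
  refine ⟨Matrix.of fun p q =>
    N (Function.update (fun k => Classical.arbitrary (α k)) j p.1, p.2)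
      (Function.update (fun k => Classical.arbitrary (α k)) j q.1, q.2), ?_⟩
  ext ⟨x, l⟩ ⟨y, m⟩
  rw [lift_apply]
  split_ifs with h
  · have h1 := eq_of_update_invariant
      (f := fun z => N (Function.update z j (x j), l) (Function.update z j (y j), m))
      ?_ x fun k => Classical.arbitrary (α k)
    · have hy : Function.update x j (y j) = y := by
        funext k
        by_cases hk : k = j
        · subst hk; simp
        · simpa [hk] using h k hk
      simpa [hy] using h1
    · intro i z q
      by_cases hij : i = j
      · subst hij; simp
      have h2 := hdiag i hij (Function.update z j (x j), l) (Function.update z j (y j), m)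
        (by simp [hij]) q
      dsimp only at h2 ⊢
      rw [← h2, Function.update_comm hij, Function.update_comm hij]
  · push Not at h
    obtain ⟨i, hij, hi⟩ := h
    exact hoff i hij _ _ hi

end Local

/-! ### Distributing a system over several parties -/

section Distribute

variable {l : Type} [Fintype l] [DecidableEq l]

/-- The ordered product `Q₀(m₀) Q₁(m₁) ⋯` of members of several Kraus families. -/
def prodKraus {κ : Type} {n : ℕ} (Q : Fin n → κ → Op l) (m : Fin n → κ) : Op l :=
  (List.ofFn fun i => Q i (m i)).prod

lemma prodKraus_succ {κ : Type} {n : ℕ} (Q : Fin (n + 1) → κ → Op l) (m : Fin (n + 1) → κ) :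
    prodKraus Q m = Q 0 (m 0) * prodKraus (fun i => Q i.succ) fun i => m i.succ := by
  simp [prodKraus, List.ofFn_succ]

lemma sum_prodKraus {κ : Type} [Fintype κ] {n : ℕ} (Q : Fin n → κ → Op l)
    (hQ : ∀ i, ∑ m, (Q i m)ᴴ * Q i m = 1) :
    ∑ m, (prodKraus Q m)ᴴ * prodKraus Q m = 1 := by
  induction n with
  | zero => simp [prodKraus]
  | succ n ih =>
    rw [← (Fin.consEquiv fun _ : Fin (n + 1) => κ).sum_comp, Fintype.sum_prod_type, Finset.sum_comm]
    simp only [prodKraus_succ, Fin.consEquiv_apply, Fin.cons_zero, Fin.cons_succ]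
    rw [← ih (fun i => Q i.succ) fun i => hQ _]
    refine Finset.sum_congr rfl fun m _ => ?_
    have : ∀ a, (Q 0 a * prodKraus (fun i => Q i.succ) m)ᴴ *
        (Q 0 a * prodKraus (fun i => Q i.succ) m) =
        (prodKraus (fun i => Q i.succ) m)ᴴ * ((Q 0 a)ᴴ * Q 0 a) *
          prodKraus (fun i => Q i.succ) m := fun a => by
      simp only [conjTranspose_mul, Matrix.mul_assoc]
    simp only [this, ← Finset.sum_mul, ← Finset.mul_sum, hQ, Matrix.mul_one]

/-- If the `i`-th family intertwines `s` with its action on the first part of the outcome, and the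
other families commute with `s`, then the products intertwine `s` with its action on the `i`-th
outcome. -/
lemma prodKraus_mul {β : Type} {n : ℕ} (Q : Fin n → l × β → Op l) (i : Fin n) (s : Op l)
    (hc : ∀ j, j ≠ i → ∀ m, Commute (Q j m) s)
    (hs : ∀ a b, Q i (a, b) * s = ∑ a', s a a' • Q i (a', b)) (m : Fin n → l × β) :
    prodKraus Q m * s =
      ∑ a', s (m i).1 a' • prodKraus Q (Function.update m i (a', (m i).2)) := by
  induction n with
  | zero => exact i.elim0
  | succ n ih =>
    rw [prodKraus_succ, Matrix.mul_assoc]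
    induction i using Fin.cases with
    | zero =>
      have hcomm : Commute (prodKraus (fun i => Q i.succ) fun i => m i.succ) s := by
        refine Commute.list_prod_left _ _ fun x hx => ?_
        obtain ⟨j, rfl⟩ := List.mem_ofFn.1 hx
        exact hc _ (Fin.succ_ne_zero j) _
      rw [hcomm.eq, ← Matrix.mul_assoc, ← Prod.mk.eta (p := m 0), hs, Finset.sum_mul]
      refine Finset.sum_congr rfl fun a' _ => ?_
      rw [prodKraus_succ]
      simp
    | succ i =>
      rw [ih (fun i => Q i.succ) i (fun j hj => hc _ (by simpa using hj)) hs, Finset.mul_sum]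
      refine Finset.sum_congr rfl fun a' _ => ?_
      rw [prodKraus_succ, Matrix.mul_smul]
      congr 3
      funext j
      by_cases h : j = i
      · subst h; simp
      · rw [Function.update_of_ne h, Function.update_of_ne (by simpa using h)]

/-- Given pairwise commuting star-closed sets `S i` of operators on `ℂ^l`, there is an isometry
`J` from `ℂ^l` to a tensor product of copies of `ℂ^l ⊗ (ℂ^l ⊗ ℂ^l)` that intertwines every
`s ∈ S i` with `s` acting on the `i`-th of the copies only. -/
lemma exists_distributing_isometry {n : ℕ} (hn : 0 < n) (S : Fin n → Set (Op l))
    (hstar : ∀ i, ∀ s ∈ S i, sᴴ ∈ S i)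
    (hcomm : ∀ i j, i ≠ j → ∀ s ∈ S i, ∀ t ∈ S j, Commute s t) :
    ∃ J : Matrix (Fin n → l × (l × l)) l ℂ, Jᴴ * J = 1 ∧
      ∀ i, ∀ s ∈ S i, ∀ ξ w, (J * s) ξ w =
        ∑ a', s (ξ i).1 a' * J (Function.update ξ i (a', (ξ i).2)) w := by
  choose Q hQmem hQ1 hQs using fun i => exists_adapted_kraus (hstar i)
  -- The output index `k` of the product of Kraus operators belongs to an additional copy of `ℂ^l`,
  -- which has to be handed to the parties; copying it in the standard basis to all of them treats
  -- them alike. That there is at least one party is needed for the isometry property.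
  let J : Matrix (Fin n → l × (l × l)) l ℂ := Matrix.of fun ξ w =>
    ∑ k, if (fun i => (ξ i).2.2) = (fun _ => k) then
      prodKraus Q (fun i => ((ξ i).1, (ξ i).2.1)) k w else 0
  have hJ : ∀ ξ w, J ξ w = ∑ k, if (fun i => (ξ i).2.2) = (fun _ => k) then
      prodKraus Q (fun i => ((ξ i).1, (ξ i).2.1)) k w else 0 := fun _ _ => rfl
  have hinj : ∀ k k' : l, (fun _ : Fin n => k) = (fun _ => k') ↔ k = k' := fun k k' =>
    ⟨fun h => congrFun h ⟨0, hn⟩, fun h => by rw [h]⟩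
  refine ⟨J, ?_, ?_⟩
  · rw [← sum_prodKraus Q hQ1]
    ext v w
    rw [Matrix.mul_apply, Matrix.sum_apply]
    simp only [Matrix.mul_apply, conjTranspose_apply]
    rw [← ((Equiv.arrowProdEquivProdArrow (Fin n) (fun _ => l × l) (fun _ => l)).symm.trans
      (Equiv.piCongrRight fun _ : Fin n => Equiv.prodAssoc l l l)).sum_comp, Fintype.sum_prod_type]
    refine Finset.sum_congr rfl fun m _ => ?_
    have : ∀ (f : Fin n → l) (w : l), J ((((Equiv.arrowProdEquivProdArrow (Fin n) (fun _ => l × l)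
        (fun _ => l)).symm.trans
      (Equiv.piCongrRight fun _ : Fin n => Equiv.prodAssoc l l l))) (m, f)) w =
        ∑ k, if f = (fun _ => k) then prodKraus Q m k w else 0 := fun _ _ => rfl
    simp only [this]
    simp only [star_sum, Finset.sum_mul]
    rw [Finset.sum_comm]
    refine Finset.sum_congr rfl fun k _ => ?_
    rw [Finset.sum_eq_single (fun _ => k)]
    · simp [hinj]
    · intro f _ hf
      simp [hf]
    · simp
  · intro i s hs ξ w
    have h1 := prodKraus_mul Q i s (fun j hj m => ((hQmem j m s fun t ht =>
        (hcomm j i hj t ht s hs)) : s * Q j m = Q j m * s).symm) (hQs i s hs)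
      (fun i => ((ξ i).1, (ξ i).2.1))
    have h2 : ∀ k, (prodKraus Q (fun i => ((ξ i).1, (ξ i).2.1)) * s) k w =
        ∑ a', s (ξ i).1 a' * prodKraus Q
          (fun j => ((Function.update ξ i (a', (ξ i).2) j).1,
            (Function.update ξ i (a', (ξ i).2) j).2.1)) k w := by
      intro k
      rw [h1, Matrix.sum_apply]
      refine Finset.sum_congr rfl fun a' _ => ?_
      rw [Matrix.smul_apply, smul_eq_mul]
      congr 3
      funext j
      by_cases h : j = i
      · subst h; simp
      · simp [h]
    have h3 : ∀ a', (fun j => (Function.update ξ i (a', (ξ i).2) j).2.2) =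
        fun j => (ξ j).2.2 := by
      intro a'
      funext j
      by_cases h : j = i
      · subst h; simp
      · simp [h]
    simp only [Matrix.mul_apply, hJ, h3, Finset.sum_mul, Finset.mul_sum] at h2 ⊢
    rw [Finset.sum_comm]
    conv_rhs => rw [Finset.sum_comm]
    refine Finset.sum_congr rfl fun k _ => ?_
    split_ifs
    · exact h2 k
    · simp

end Distribute

/-! ### Splitting off a factor of a tensor product -/

section Splitting

/-- The isometry `v ↦ ∑ₖ |k⟩ ⊗ π(|k₀⟩⟨k|) v` exhibiting the space of a representation `π` of
a full matrix algebra as a multiple of the defining representation. -/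
def splitIsometry {β H : Type} [DecidableEq β] [Nonempty β] (π : Op β → Op H) :
    Matrix (β × H) H ℂ :=
  Matrix.of fun p h => π (single (Classical.arbitrary β) p.1 1) p.2 h

variable {β H : Type} [Fintype β] [DecidableEq β] [Nonempty β] [Fintype H] [DecidableEq H]

lemma splitIsometry_isometry {π : Op β → Op H} (hmul : ∀ a b, π (a * b) = π a * π b)
    (hstar : ∀ a, π aᴴ = (π a)ᴴ) (hadd : ∀ s : β → Op β, π (∑ k, s k) = ∑ k, π (s k))
    (hone : π 1 = 1) : (splitIsometry π)ᴴ * splitIsometry π = 1 := by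
  have h1 : (1 : Op β) = ∑ k, (single (Classical.arbitrary β) k (1 : ℂ))ᴴ *
      single (Classical.arbitrary β) k 1 := by
    ext i j
    simp [Matrix.sum_apply, single_apply, one_apply, conjTranspose_single, ite_and]
  rw [← hone, h1, hadd]
  simp only [hmul, hstar]
  ext h h'
  simp [Matrix.mul_apply, Matrix.sum_apply, splitIsometry, Fintype.sum_prod_type]

lemma kronecker_one_mul_splitIsometry {π : Op β → Op H} (hmul : ∀ a b, π (a * b) = π a * π b)
    (hlin : ∀ (c : β → ℂ) (s : β → Op β), π (∑ k, c k • s k) = ∑ k, c k • π (s k)) (a : Op β) :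
    (a ⊗ₖ (1 : Op H)) * splitIsometry π = splitIsometry π * π a := by
  ext ⟨k, y⟩ h
  have h1 : single (Classical.arbitrary β) k (1 : ℂ) * a =
      ∑ b, a k b • single (Classical.arbitrary β) b (1 : ℂ) := by
    ext i j
    simp [Matrix.sum_apply, single_apply, Matrix.mul_apply, ite_and, eq_comm]
  have h2 : (splitIsometry π * π a) (k, y) h =
      π (single (Classical.arbitrary β) k (1 : ℂ) * a) y h := by
    rw [hmul]; rfl
  rw [h2, h1, hlin]
  simp [Matrix.mul_apply, Matrix.sum_apply, splitIsometry, Fintype.sum_prod_type, one_apply]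

end Splitting

/-! ### The matrix form of separable dynamics -/

lemma lift_kronecker_one {I : Type} [Fintype I] [DecidableEq I] {α : I → Type}
    [∀ i, Fintype (α i)] [∀ i, DecidableEq (α i)] {L : Type} [Fintype L] [DecidableEq L]
    (i : I) (a : Op (α i)) :
    lift i (a ⊗ₖ (1 : Op L)) = piKron (Function.update (fun _ => 1) i a) ⊗ₖ (1 : Op L) := by
  ext x y
  rw [lift_apply, kroneckerMap_apply, kroneckerMap_apply, piKron_update_one]
  split_ifs <;> simp

lemma commute_lift_kronecker_one {I : Type} [Fintype I] [DecidableEq I] {α : I → Type}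
    [∀ i, Fintype (α i)] [∀ i, DecidableEq (α i)] {L : Type} [Fintype L] [DecidableEq L]
    {i j : I} (hij : i ≠ j) (a : Op (α i)) (b : Op (α j)) :
    Commute (lift i (a ⊗ₖ (1 : Op L))) (lift j (b ⊗ₖ (1 : Op L))) := by
  change _ * _ = _ * _
  simp only [lift_kronecker_one, ← mul_kronecker_mul, piKron_mul]
  congr 2
  funext k
  by_cases hi : k = i
  · subst hi; simp [hij]
  · simp [hi]

/-- Operators `a ⊗ 1` on one factor `β i` of `⊗ᵢ (β i ⊗ γ i)`, after regrouping. -/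
lemma piKron_update_kronecker_one {I : Type} [Fintype I] [DecidableEq I] {β γ : I → Type}
    [∀ i, Fintype (β i)] [∀ i, DecidableEq (β i)] [∀ i, Fintype (γ i)] [∀ i, DecidableEq (γ i)]
    (i : I) (a : Op (β i)) :
    (piKron (α := fun i => β i × γ i) (β := fun i => β i × γ i)
      (Function.update (fun _ => 1) i (a ⊗ₖ (1 : Op (γ i))))).submatrix
        (Equiv.arrowProdEquivProdArrow I β γ).symm (Equiv.arrowProdEquivProdArrow I β γ).symm =
      lift i (a ⊗ₖ (1 : Op (∀ i, γ i))) := by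
  ext ⟨x, y⟩ ⟨x', y'⟩
  rw [submatrix_apply, piKron_update_one (α := fun i => β i × γ i), lift_apply]
  simp only [Equiv.arrowProdEquivProdArrow_symm_apply, kroneckerMap_apply, one_apply,
    Prod.mk.injEq]
  by_cases hy : y = y'
  · subst hy; simp
  · obtain ⟨k, hk⟩ := Function.ne_iff.1 hy
    by_cases hki : k = i
    · subst hki; simp [hy, hk]
    · rw [if_neg fun h => hk (h k hki).2]
      simp [hy]

/-- The intertwining property of a distributing isometry, for operators on `A i ⊗ L` whose
components on `L` it intertwines. -/
lemma one_kronecker_mul_lift {I : Type} [Fintype I] [DecidableEq I] {α : I → Type}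
    [∀ i, Fintype (α i)] [∀ i, DecidableEq (α i)] {L Z : Type} [Fintype L] [DecidableEq L]
    [Fintype Z] [DecidableEq Z] (i : I) (M : Op (α i × L)) (J : Matrix (I → L × Z) L ℂ)
    (hJ : ∀ p q ξ w, (J * slice M p q) ξ w =
      ∑ a', slice M p q (ξ i).1 a' * J (Function.update ξ i (a', (ξ i).2)) w) :
    ((1 : Op (∀ i, α i)) ⊗ₖ J).submatrix
        (Equiv.arrowProdEquivProdArrow I α fun _ => L × Z) id * lift i M =
      piKron (α := fun i => α i × (L × Z)) (β := fun i => α i × (L × Z))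
          (Function.update (fun _ => 1) i ((M ⊗ₖ (1 : Op Z)).submatrix
            (Equiv.prodAssoc (α i) L Z).symm (Equiv.prodAssoc (α i) L Z).symm)) *
        ((1 : Op (∀ i, α i)) ⊗ₖ J).submatrix
          (Equiv.arrowProdEquivProdArrow I α fun _ => L × Z) id := by
  ext ζ ⟨y, w⟩
  obtain ⟨⟨x, ξ⟩, rfl⟩ := (Equiv.arrowProdEquivProdArrow I α fun _ => L × Z).symm.surjective ζ
  rw [Matrix.mul_apply, Matrix.mul_apply,
    ← (Equiv.arrowProdEquivProdArrow I α fun _ => L × Z).symm.sum_comp, Fintype.sum_prod_type,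
    Fintype.sum_prod_type, Finset.sum_eq_single x, Finset.sum_eq_single y]
  · simp only [submatrix_apply, Equiv.apply_symm_apply, kroneckerMap_apply, id, one_apply_eq,
      one_mul, piKron_update_one (α := fun i => α i × (L × Z)),
      Equiv.arrowProdEquivProdArrow_symm_apply, lift_apply, Equiv.prodAssoc_symm_apply]
    by_cases h : ∀ k, k ≠ i → x k = y k
    · have h1 := hJ (x i) (y i) ξ w
      rw [Matrix.mul_apply] at h1
      simp only [slice_apply] at h1
      simp only [if_pos h]
      refine h1.trans ?_
      refine Finset.sum_of_injOn (fun a' => Function.update ξ i (a', (ξ i).2)) ?_ ?_ ?_ ?_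
      · intro a _ b _ hab
        exact (Prod.ext_iff.1 (Function.update_injective ξ i hab)).1
      · simp
      · intro η _ hη
        refine mul_eq_zero_of_left ?_ _
        split_ifs with h2
        · have hz : (ξ i).2 ≠ (η i).2 := by
            intro hz
            refine hη ⟨(η i).1, by simp, funext fun k => ?_⟩
            by_cases hk : k = i
            · subst hk; simp [hz]
            · have := h2 k hk
              simp only [Prod.mk.injEq] at this
              simp [hk, this.2]
          simp [one_apply, hz]
        · rfl
      · intro a _
        rw [if_pos]
        · simp [one_apply]
        · intro k hk
          simp [hk, h k hk]
    · simp only [if_neg h, mul_zero, Finset.sum_const_zero]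
      symm
      refine Finset.sum_eq_zero fun η _ => mul_eq_zero_of_left (if_neg fun h2 => h ?_) _
      intro k hk
      exact (Prod.mk.inj (h2 k hk)).1
  · intro z _ hz
    refine Finset.sum_eq_zero fun η _ => ?_
    simp [one_apply, hz]
  · simp
  · intro z _ hz
    refine Finset.sum_eq_zero fun η _ => ?_
    simp [one_apply, hz.symm]
  · simp

section Core

variable {n : ℕ} {α α' : Fin n → Type} {L F : Type}
  [∀ i, Fintype (α i)] [∀ i, DecidableEq (α i)] [∀ i, Nonempty (α i)]
  [∀ i, Fintype (α' i)] [∀ i, DecidableEq (α' i)] [∀ i, Nonempty (α' i)]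
  [Fintype L] [DecidableEq L] [Fintype F] [DecidableEq F]

/-- An operator on `ℂ^ι ⊗ ℂ^L`, acting on `ℂ^ι ⊗ (ℂ^L ⊗ ℂ^Z)`. -/
def extendRight {ι L : Type} (Z : Type) [DecidableEq Z] (M : Op (ι × L)) : Op (ι × (L × Z)) :=
  (M ⊗ₖ (1 : Op Z)).submatrix (Equiv.prodAssoc ι L Z).symm (Equiv.prodAssoc ι L Z).symm

/-- If the `N i a` on `Aᵢ ⊗ L` are the Heisenberg-evolved operators of the outputs `A'ᵢ` of a
unitary `U`, then `U` is, up to an isometry on `F`, a parallel composition of isometries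
`Aᵢ ⊗ Xᵢ → A'ᵢ ⊗ Yᵢ` after an isometry `L → ⊗ᵢ Xᵢ`; here `Yᵢ = Aᵢ ⊗ Xᵢ`. -/
theorem exists_isometric_separation (hn : 0 < n)
    (U : Matrix ((∀ i, α' i) × F) ((∀ i, α i) × L) ℂ) (hU : Uᴴ * U = 1) (hU' : U * Uᴴ = 1)
    (N : ∀ i, Op (α' i) → Op (α i × L))
    (hN : ∀ i a, Uᴴ * lift i (a ⊗ₖ (1 : Op F)) * U = lift i (N i a)) :
    ∃ (J : Matrix (Fin n → L × (L × L)) L ℂ)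
      (S : ∀ i, Matrix (α' i × (α i × (L × (L × L)))) (α i × (L × (L × L))) ℂ)
      (Q : Matrix (∀ i, α i × (L × (L × L))) F ℂ),
      Jᴴ * J = 1 ∧ (∀ i, (S i)ᴴ * S i = 1) ∧ Qᴴ * Q = 1 ∧
      (piKron S).submatrix
          (Equiv.arrowProdEquivProdArrow (Fin n) α' fun i => α i × (L × (L × L))).symm
          (Equiv.arrowProdEquivProdArrow (Fin n) α fun _ => L × (L × L)).symm *
        ((1 : Op (∀ i, α i)) ⊗ₖ J) = ((1 : Op (∀ i, α' i)) ⊗ₖ Q) * U := by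
  have hsand : ∀ M M' : Op ((∀ i, α' i) × F),
      (Uᴴ * M * U) * (Uᴴ * M' * U) = Uᴴ * (M * M') * U := by
    intro M M'
    calc _ = Uᴴ * M * (U * Uᴴ) * M' * U := by simp only [Matrix.mul_assoc]
      _ = _ := by rw [hU']; simp only [Matrix.mul_assoc, Matrix.one_mul]
  -- The maps `N i` are representations of matrix algebras on `Aᵢ ⊗ L`.
  have hNmul : ∀ i a b, N i (a * b) = N i a * N i b := by
    intro i a b
    apply lift_injective i
    rw [lift_mul, ← hN, ← hN, ← hN, hsand, ← lift_mul, ← mul_kronecker_mul, Matrix.one_mul]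
  have hNstar : ∀ i a, N i aᴴ = (N i a)ᴴ := by
    intro i a
    apply lift_injective i
    rw [lift_conjTranspose, ← hN, ← hN, ← conjTranspose_one, ← conjTranspose_kronecker,
      lift_conjTranspose]
    simp only [conjTranspose_mul, conjTranspose_conjTranspose, Matrix.mul_assoc, conjTranspose_one]
  have hNone : ∀ i, N i 1 = 1 := by
    intro i
    apply lift_injective i
    rw [← hN, one_kronecker_one, lift_one, Matrix.mul_one, hU, lift_one]
  have hNlin : ∀ i (c : α' i → ℂ) (s : α' i → Op (α' i)),
      N i (∑ k, c k • s k) = ∑ k, c k • N i (s k) := by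
    intro i c s
    apply lift_injective i
    have h1 : lift i ((∑ k, c k • s k) ⊗ₖ (1 : Op F)) =
        ∑ k, c k • lift i (s k ⊗ₖ (1 : Op F)) := by
      ext x y
      by_cases h : ∀ k, k ≠ i → x.1 k = y.1 k <;>
        simp [lift_apply, Matrix.sum_apply, h, Finset.sum_mul, mul_assoc]
    have h2 : lift i (∑ k, c k • N i (s k)) = ∑ k, c k • lift i (N i (s k)) := by
      ext x y
      by_cases h : ∀ k, k ≠ i → x.1 k = y.1 k <;>
        simp [lift_apply, Matrix.sum_apply, h]
    rw [← hN, h1, h2, Matrix.mul_sum, Matrix.sum_mul]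
    simp [← hN]
  have hNcomm : ∀ i j, i ≠ j → ∀ a b, Commute (lift i (N i a)) (lift j (N j b)) := by
    intro i j hij a b
    rw [← hN, ← hN]
    change _ * _ = _ * _
    rw [hsand, hsand, (commute_lift_kronecker_one hij a b).eq]
  -- Distribute `L` along the algebras of the components of the `N i a`.
  obtain ⟨J, hJ, hJs⟩ := exists_distributing_isometry hn
    (fun i => {s : Op L | ∃ a p q, s = slice (N i a) p q})
    (by
      rintro i _ ⟨a, p, q, rfl⟩
      exact ⟨aᴴ, q, p, by rw [hNstar]; rfl⟩)
    (by
      rintro i j hij _ ⟨a, p, q, rfl⟩ _ ⟨b, r, t, rfl⟩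
      exact commute_slice hij (hNcomm i j hij a b) p q r t)
  let π : ∀ i, Op (α' i) → Op (α i × (L × (L × L))) := fun i a => extendRight (L × L) (N i a)
  have hπmul : ∀ i a b, π i (a * b) = π i a * π i b := by
    intro i a b
    simp only [π, extendRight, hNmul, submatrix_mul_equiv, ← mul_kronecker_mul, Matrix.one_mul]
  have hπstar : ∀ i a, π i aᴴ = (π i a)ᴴ := by
    intro i a
    simp only [π, extendRight, hNstar, conjTranspose_submatrix, conjTranspose_kronecker,
      conjTranspose_one]
  have hπone : ∀ i, π i 1 = 1 := by
    intro i
    simp [π, extendRight, hNone]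
  have hπlin : ∀ i (c : α' i → ℂ) (s : α' i → Op (α' i)),
      π i (∑ k, c k • s k) = ∑ k, c k • π i (s k) := by
    intro i c s
    ext x y
    simp [π, extendRight, hNlin, Matrix.sum_apply, Finset.sum_mul, mul_assoc]
  let S := fun i => splitIsometry (π i)
  have hS : ∀ i, (S i)ᴴ * S i = 1 := fun i =>
    splitIsometry_isometry (hπmul i) (hπstar i) (fun s => by simpa using hπlin i 1 s) (hπone i)
  have hSπ : ∀ i a, (a ⊗ₖ (1 : Op (α i × (L × (L × L))))) * S i = S i * π i a := fun i a =>
    kronecker_one_mul_splitIsometry (hπmul i) (hπlin i) a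
  let e := Equiv.arrowProdEquivProdArrow (Fin n) α fun _ => L × (L × L)
  let e' := Equiv.arrowProdEquivProdArrow (Fin n) α' fun i => α i × (L × (L × L))
  let J' : Matrix (∀ i, α i × (L × (L × L))) ((∀ i, α i) × L) ℂ :=
    ((1 : Op (∀ i, α i)) ⊗ₖ J).submatrix e id
  let B : ∀ i, Op (α' i) → Op (∀ i, α i × (L × (L × L))) := fun i a =>
    piKron (Function.update (fun _ => 1) i (π i a))
  have hJ' : ∀ i a, J' * lift i (N i a) = B i a * J' := fun i a =>
    one_kronecker_mul_lift i (N i a) J fun p q => hJs i _ ⟨a, p, q, rfl⟩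
  let D : ∀ i, Op (α' i) → Op (∀ i, α' i × (α i × (L × (L × L)))) := fun i a =>
    piKron (Function.update (fun _ => 1) i (a ⊗ₖ (1 : Op (α i × (L × (L × L))))))
  have hD : ∀ i a, D i a * piKron S = piKron S * B i a := by
    intro i a
    simp only [D, B, piKron_mul]
    congr 1
    funext k
    by_cases h : k = i
    · subst h; simp [hSπ]
    · simp [h]
  have hU2 : ∀ i a, lift i (N i a) * Uᴴ = Uᴴ * lift i (a ⊗ₖ (1 : Op F)) := by
    intro i a
    rw [← hN, Matrix.mul_assoc, hU', Matrix.mul_one]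
  -- `W` is the circuit of isometries; `W U†` intertwines the operators on the outputs `A'ᵢ`.
  let W := piKron S * J'
  have hWU : ∀ i a, D i a * (W * Uᴴ) = (W * Uᴴ) * lift i (a ⊗ₖ (1 : Op F)) := by
    intro i a
    calc D i a * (W * Uᴴ) = (D i a * piKron S) * J' * Uᴴ := by simp only [W, Matrix.mul_assoc]
      _ = piKron S * (B i a * J') * Uᴴ := by rw [hD]; simp only [Matrix.mul_assoc]
      _ = piKron S * J' * (lift i (N i a) * Uᴴ) := by rw [← hJ']; simp only [Matrix.mul_assoc]
      _ = _ := by rw [hU2]; simp only [W, Matrix.mul_assoc]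
  obtain ⟨Q, hQ⟩ := exists_eq_one_kronecker ((W * Uᴴ).submatrix e'.symm id) (by
    intro i a
    have h1 : (D i a).submatrix e'.symm e'.symm =
      lift i (a ⊗ₖ (1 : Op (∀ i, α i × (L × (L × L))))) := piKron_update_kronecker_one i a
    rw [← h1, submatrix_mul_equiv, hWU]
    rfl)
  have hWe : W.submatrix e'.symm id = ((1 : Op (∀ i, α' i)) ⊗ₖ Q) * U := by
    rw [← hQ]
    have : W = W * Uᴴ * U := by rw [Matrix.mul_assoc, hU, Matrix.mul_one]
    conv_lhs => rw [this]
    rfl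
  have hJ'1 : J'ᴴ * J' = 1 := by
    simp only [J', conjTranspose_submatrix, conjTranspose_kronecker, submatrix_mul_equiv,
      ← mul_kronecker_mul, hJ, conjTranspose_one, Matrix.one_mul, one_kronecker_one,
      submatrix_id_id]
  have hW : Wᴴ * W = 1 := by
    calc Wᴴ * W = J'ᴴ * ((piKron S)ᴴ * piKron S) * J' := by
          simp only [W, conjTranspose_mul, Matrix.mul_assoc]
      _ = 1 := by
        simp only [piKron_conjTranspose, piKron_mul, hS, piKron_one, Matrix.mul_one, hJ'1]
  have hQ1 : Qᴴ * Q = 1 := by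
    have h1 : (1 : Op (∀ i, α' i)) ⊗ₖ (Qᴴ * Q) = 1 := by
      calc _ = (((1 : Op (∀ i, α' i)) ⊗ₖ Q))ᴴ * ((1 : Op (∀ i, α' i)) ⊗ₖ Q) := by
            rw [conjTranspose_kronecker, ← mul_kronecker_mul, conjTranspose_one, Matrix.one_mul]
        _ = (W * Uᴴ)ᴴ * (W * Uᴴ) := by
            rw [← hQ, conjTranspose_submatrix, submatrix_mul_equiv, submatrix_id_id]
        _ = U * (Wᴴ * W) * Uᴴ := by
            simp only [conjTranspose_mul, conjTranspose_conjTranspose, Matrix.mul_assoc]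
        _ = 1 := by rw [hW, Matrix.mul_one, hU']
    ext f f'
    have h2 := congrFun (congrFun h1 (fun i => Classical.arbitrary (α' i), f))
      (fun i => Classical.arbitrary (α' i), f')
    rw [kronecker_apply, one_apply_eq, one_mul] at h2
    rw [h2]
    simp [one_apply]
  refine ⟨J, S, Q, hJ, hS, hQ1, ?_⟩
  rw [← hWe]
  have h1 : (1 : Op (∀ i, α i)) ⊗ₖ J = J'.submatrix e.symm id := by
    simp [J', submatrix_submatrix]
  rw [h1]
  exact submatrix_mul_equiv (piKron S) J' e'.symm e.symm id

end Core

/-! ### No influence in the Heisenberg picture -/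

section NoInfluence

variable {I J : Type} [Fintype I] [DecidableEq I] [Fintype J] [DecidableEq J]
  {α : I → Type} [∀ i, Fintype (α i)] [∀ i, DecidableEq (α i)]
  {β : J → Type} [∀ i, Fintype (β i)] [∀ i, DecidableEq (β i)]

lemma trace_mul_discardAllBut (j : J) (a : Op (β j)) (M : Op (∀ j, β j)) :
    (a * discardAllBut β j M).trace = (piKron (Function.update (fun _ => 1) j a) * M).trace := by
  let e := Equiv.piSplitAt j β
  have hK : ∀ p q r r', piKron (Function.update (fun _ => 1) j a) (e.symm (p, r)) (e.symm (q, r')) =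
      if r = r' then a p q else 0 := by
    intro p q r r'
    rw [piKron_update_one]
    have h1 : (∀ k, k ≠ j → e.symm (p, r) k = e.symm (q, r') k) ↔ r = r' := by
      constructor
      · intro h
        funext k
        have := h k k.2
        simpa [e, k.2] using this
      · rintro rfl k hk
        simp [e, hk]
    simp only [h1]
    simp [e]
  simp only [Matrix.trace, Matrix.diag, Matrix.mul_apply]
  rw [← e.symm.sum_comp, Fintype.sum_prod_type]
  refine Finset.sum_congr rfl fun p _ => ?_
  have h2 : ∀ q, discardAllBut β j M q p = ∑ r, M (e.symm (q, r)) (e.symm (p, r)) := fun q => by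
    simp only [discardAllBut, LinearMap.comp_apply, discardRight_apply, relabel_apply]
    rfl
  simp only [h2, Finset.mul_sum]
  rw [Finset.sum_comm]
  refine Finset.sum_congr rfl fun r _ => ?_
  rw [← e.symm.sum_comp, Fintype.sum_prod_type]
  refine Finset.sum_congr rfl fun q _ => ?_
  simp only [hK, ite_mul, zero_mul, Finset.sum_ite_eq, Finset.mem_univ, if_true]

lemma discardAt_single (i : I) (x y : ∀ i, α i) :
    discardAt α i (single x y 1) =
      if x i = y i then single (fun k : {k // k ≠ i} => x k) (fun k : {k // k ≠ i} => y k) 1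
      else 0 := by
  ext p q
  simp only [discardAt, LinearMap.comp_apply, relabel_single, discardRight_apply]
  have h : ∀ z, ((Equiv.piSplitAt i α).trans (Equiv.prodComm _ _)) z =
    ((fun k : {k // k ≠ i} => z k), z i) := fun _ => rfl
  simp only [h, single_apply, Prod.mk.injEq]
  split_ifs with hxy
  · simp only [hxy, single_apply]
    by_cases h2 : (fun k : {k // k ≠ i} => x k) = p ∧ (fun k : {k // k ≠ i} => y k) = q
    · simp [h2]
    · rw [if_neg h2, Finset.sum_eq_zero]
      intro c _
      rw [if_neg]
      tauto
  · refine Finset.sum_eq_zero fun c _ => if_neg ?_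
    rintro ⟨⟨-, h1⟩, -, h2⟩
    exact hxy (h1.trans h2.symm)

/-- If `A i` does not influence `B j` through the unitary channel of `U`, then the entries of the
Heisenberg-evolved operators of `B j` only depend on the index `i` through a Kronecker delta. -/
lemma heisenberg_entry {i : I} {j : J} (U : Matrix (∀ j, β j) (∀ i, α i) ℂ)
    {T : Op (∀ k : {k // k ≠ i}, α k) →ₗ[ℂ] Op (β j)}
    (hT : discardAllBut β j ∘ₗ conj U = T ∘ₗ discardAt α i) (a : Op (β j)) (x y : ∀ i, α i) :
    (Uᴴ * piKron (Function.update (fun _ => 1) j a) * U) x y =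
      if y i = x i then
        (a * T (single (fun k : {k // k ≠ i} => y k) (fun k : {k // k ≠ i} => x k) 1)).trace
      else 0 := by
  have h1 := trace_mul_discardAllBut j a (conj U (single y x 1))
  rw [← LinearMap.comp_apply, hT, LinearMap.comp_apply, discardAt_single] at h1
  have h2 : (piKron (Function.update (fun _ => 1) j a) * conj U (single y x 1)).trace =
      (Uᴴ * piKron (Function.update (fun _ => 1) j a) * U) x y := by
    rw [conj_apply, ← Matrix.mul_assoc, Matrix.trace_mul_comm, ← Matrix.mul_assoc,
      ← Matrix.mul_assoc, Matrix.trace_mul_single]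
    simp
  rw [← h2, ← h1]
  split_ifs <;> simp

end NoInfluence

/-! ### Separable dynamics of unitary channels -/

section Separable

/-- An isometry has a left inverse in the category of channels. -/
lemma exists_channel_leftInverse {ι κ : Type} [Fintype ι] [DecidableEq ι] [Nonempty ι]
    [Fintype κ] [DecidableEq κ] (Q : Matrix κ ι ℂ) (hQ : Qᴴ * Q = 1) :
    ∃ R : Op κ →ₗ[ℂ] Op ι, IsCP R ∧ (∀ ρ, (R ρ).trace = ρ.trace) ∧
      R ∘ₗ conj Q = LinearMap.id := by
  let P : Op κ := 1 - Q * Qᴴ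
  have hPQ : P * Q = 0 := by
    simp [P, Matrix.sub_mul, Matrix.mul_assoc, hQ]
  have hP : Pᴴ * P = P := by
    have h1 : Pᴴ = P := by simp [P]
    have h2 : P * (Q * Qᴴ) = 0 := by rw [← Matrix.mul_assoc, hPQ, Matrix.zero_mul]
    calc Pᴴ * P = P * (1 - Q * Qᴴ) := by rw [h1]
      _ = P := by rw [Matrix.mul_sub, h2, Matrix.mul_one, sub_zero]
  -- On the complement of the range of `Q`, a fixed basis state is prepared.
  let f : ι := Classical.arbitrary ι
  refine ⟨∑ o : Option κ, conj (o.elim Qᴴ fun y => (single f y 1 : Matrix ι κ ℂ) * P),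
    isCP_sum fun _ => isCP_conj _, fun ρ => ?_, ?_⟩
  · have h1 : ∀ y, ((single f y 1 : Matrix ι κ ℂ) * P)ᴴ * ((single f y 1 : Matrix ι κ ℂ) * P) =
        Pᴴ * single y y 1 * P := by
      intro y
      rw [conjTranspose_mul, conjTranspose_single, Matrix.mul_assoc, Matrix.mul_assoc,
        ← Matrix.mul_assoc (single y f _)]
      simp
    have h2 : ∑ y : κ, single y y (1 : ℂ) = 1 := by
      ext a b
      simp [Matrix.sum_apply, single_apply, one_apply, ite_and]
    simp only [Fintype.sum_option, LinearMap.add_apply, LinearMap.sum_apply, trace_add, trace_sum,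
      trace_conj, Option.elim, h1, conjTranspose_conjTranspose]
    rw [← trace_sum, ← Finset.sum_mul, ← Finset.sum_mul, ← Finset.mul_sum, h2, Matrix.mul_one, hP,
      ← trace_add, ← Matrix.add_mul]
    simp [P]
  · rw [Fintype.sum_option, LinearMap.add_comp]
    simp only [Option.elim, conj_comp_conj, hQ, conj_one]
    have : (∑ y : κ, conj ((single f y 1 : Matrix ι κ ℂ) * P)) ∘ₗ conj Q = 0 := by
      ext ρ : 1
      simp only [LinearMap.comp_apply, LinearMap.sum_apply]
      simp only [← LinearMap.comp_apply, conj_comp_conj, Matrix.mul_assoc, hPQ]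
      simp [conj_apply]
    rw [this, add_zero]

/-- A family indexed by `Option I`, as a family indexed by `I` together with a last member. -/
def optionPiEquiv {I : Type} (γ : Option I → Type) :
    ((∀ i, γ (some i)) × γ none) ≃ (∀ o, γ o) where
  toFun p
    | none => p.2
    | some i => p.1 i
  invFun x := (fun i => x (some i), x none)
  left_inv _ := rfl
  right_inv x := by
    funext o
    cases o <;> rfl

lemma optionPiEquiv_update {I : Type} [DecidableEq I] {γ : Option I → Type} (i : I) (q : γ (some i))
    (x : (∀ i, γ (some i)) × γ none) :
    optionPiEquiv γ (Function.update x.1 i q, x.2) =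
      Function.update (optionPiEquiv γ x) (some i) q := by
  funext o
  cases o with
  | none => simp [optionPiEquiv]
  | some k =>
    by_cases h : k = i
    · subst h; simp [optionPiEquiv]
    · simp [optionPiEquiv, h]

variable {n : ℕ} {γ γ' : Option (Fin n) → Type}
  [∀ i, Fintype (γ i)] [∀ i, DecidableEq (γ i)] [∀ i, Nonempty (γ i)]
  [∀ i, Fintype (γ' i)] [∀ i, DecidableEq (γ' i)] [∀ i, Nonempty (γ' i)]

/-- Separable dynamics for families of plain index types: isometries `J` and `S i` and a channel `R`
whose circuit is the given unitary channel. -/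
theorem exists_separable_circuit (hn : 0 < n) (U : Matrix (∀ o, γ' o) (∀ o, γ o) ℂ)
    (hU : Uᴴ * U = 1) (hU' : U * Uᴴ = 1)
    (hinf : ∀ i j : Fin n, i ≠ j → ∃ T, discardAllBut γ' (some j) ∘ₗ conj U =
      T ∘ₗ discardAt γ (some i)) :
    ∃ (J : Matrix (Fin n → γ none × (γ none × γ none)) (γ none) ℂ)
      (S : ∀ i, Matrix (γ' (some i) × (γ (some i) × (γ none × (γ none × γ none))))
        (γ (some i) × (γ none × (γ none × γ none))) ℂ)
      (R : Op (∀ i, γ (some i) × (γ none × (γ none × γ none))) →ₗ[ℂ] Op (γ' none)),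
      Jᴴ * J = 1 ∧ (∀ i, (S i)ᴴ * S i = 1) ∧ IsCP R ∧ (∀ ρ, (R ρ).trace = ρ.trace) ∧
      conj U =
        relabel (optionPiEquiv γ') ∘ₗ
        tensorMap (LinearMap.id : Op (∀ i, γ' (some i)) →ₗ[ℂ] _) R ∘ₗ
        relabel (Equiv.arrowProdEquivProdArrow (Fin n) (fun i => γ' (some i))
          (fun i => γ (some i) × (γ none × (γ none × γ none)))) ∘ₗ
        piTensorMap (α := fun i => γ (some i) × (γ none × (γ none × γ none)))
          (β := fun i => γ' (some i) × (γ (some i) × (γ none × (γ none × γ none))))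
          (fun i => conj (S i)) ∘ₗ
        relabel (Equiv.arrowProdEquivProdArrow (Fin n) (fun i => γ (some i))
          (fun _ => γ none × (γ none × γ none))).symm ∘ₗ
        tensorMap (LinearMap.id : Op (∀ i, γ (some i)) →ₗ[ℂ] _) (conj J) ∘ₗ
        relabel (optionPiEquiv γ).symm := by
  let U₁ := U.submatrix (optionPiEquiv γ') (optionPiEquiv γ)
  have hU₁ : U₁ᴴ * U₁ = 1 := by simp [U₁, conjTranspose_submatrix, submatrix_mul_equiv, hU]
  have hU₁' : U₁ * U₁ᴴ = 1 := by simp [U₁, conjTranspose_submatrix, submatrix_mul_equiv, hU']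
  have hlift : ∀ j (a : Op (γ' (some j))), lift j (a ⊗ₖ (1 : Op (γ' none))) =
      (piKron (Function.update (fun _ => 1) (some j) a)).submatrix
        (optionPiEquiv γ') (optionPiEquiv γ') := by
    intro j a
    ext ⟨x, l⟩ ⟨y, m⟩
    rw [lift_apply, submatrix_apply, piKron_update_one, kroneckerMap_apply, one_apply]
    have h1 : (∀ k, k ≠ some j → optionPiEquiv γ' (x, l) k = optionPiEquiv γ' (y, m) k) ↔
        (∀ k, k ≠ j → x k = y k) ∧ l = m :=
      ⟨fun h => ⟨fun k hk => h (some k) (by simpa using hk), h none (by simp)⟩, fun h o ho => by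
        cases o with
        | none => exact h.2
        | some k => exact h.1 k (by simpa using ho)⟩
    simp only [h1, ite_and]
    split_ifs
    · exact mul_one _
    · exact mul_zero _
    · rfl
  have hN : ∀ j (a : Op (γ' (some j))), ∃ N : Op (γ (some j) × γ none),
      U₁ᴴ * lift (α := fun i => γ' (some i)) j (a ⊗ₖ (1 : Op (γ' none))) * U₁ =
        lift (α := fun i => γ (some i)) j N := by
    intro j a
    refine exists_eq_lift (α := fun i => γ (some i)) j _ ?_ ?_
    all_goals
      intro i hij x y hxy
      obtain ⟨T, hT⟩ := hinf i j hij
      have h := heisenberg_entry U hT a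
      have hi : ∀ z, optionPiEquiv γ z (some i) = z.1 i := fun _ => rfl
      rw [hlift]
      simp only [U₁, conjTranspose_submatrix, submatrix_mul_equiv, submatrix_apply]
    · rw [h, hi, hi, if_neg (Ne.symm hxy)]
    · intro q
      rw [optionPiEquiv_update, optionPiEquiv_update, h, h, hi, hi, if_pos (by simp),
        if_pos hxy.symm]
      congr 4 <;> funext k <;> simp [k.2]
  choose N hN using hN
  obtain ⟨J, S, Q, hJ, hS, hQ, hE⟩ := exists_isometric_separation
    (α := fun i => γ (some i)) (α' := fun i => γ' (some i)) hn U₁ hU₁ hU₁' N hN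
  obtain ⟨R, hR, hRt, hRQ⟩ := exists_channel_leftInverse Q hQ
  refine ⟨J, S, R, hJ, hS, hR, hRt, ?_⟩
  have h1 : tensorMap (LinearMap.id : Op (∀ i, γ' (some i)) →ₗ[ℂ] _) R ∘ₗ
      conj ((1 : Op (∀ i, γ' (some i))) ⊗ₖ Q) = LinearMap.id := by
    rw [← tensorMap_conj, tensorMap_comp, hRQ, conj_one, LinearMap.id_comp, tensorMap_id_id]
  have h2 : conj U₁ = tensorMap (LinearMap.id : Op (∀ i, γ' (some i)) →ₗ[ℂ] _) R ∘ₗ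
        relabel (Equiv.arrowProdEquivProdArrow (Fin n) (fun i => γ' (some i))
          (fun i => γ (some i) × (γ none × (γ none × γ none)))) ∘ₗ
        piTensorMap (α := fun i => γ (some i) × (γ none × (γ none × γ none)))
          (β := fun i => γ' (some i) × (γ (some i) × (γ none × (γ none × γ none))))
          (fun i => conj (S i)) ∘ₗ
        relabel (Equiv.arrowProdEquivProdArrow (Fin n) (fun i => γ (some i))
          (fun _ => γ none × (γ none × γ none))).symm ∘ₗ
        tensorMap (LinearMap.id : Op (∀ i, γ (some i)) →ₗ[ℂ] _) (conj J) := by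
    rw [← LinearMap.id_comp (conj U₁), ← h1, LinearMap.comp_assoc, conj_comp_conj, ← hE,
      ← conj_comp_conj, ← tensorMap_conj, conj_one, piTensorMap_conj]
    congr 1
    rw [← LinearMap.comp_assoc (tensorMap _ _), ← LinearMap.comp_assoc (tensorMap _ _)]
    congr 1
    rw [conj_comp_relabel, relabel_comp_conj]
    rfl
  have h3 : conj U = relabel (optionPiEquiv γ') ∘ₗ conj U₁ ∘ₗ relabel (optionPiEquiv γ).symm := by
    rw [conj_comp_relabel, relabel_comp_conj]
    simp [U₁, submatrix_submatrix]
  rw [h3, h2]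
  simp only [LinearMap.comp_assoc]

/-- A unitary channel none of whose inputs `Aᵢ` influences an output `A'ⱼ` with `j ≠ i` has
separable dynamics. -/
theorem decomposesSeparably_of_noInfluence {n : ℕ} (hn : 0 < n) {A A' : Fin n → System}
    {L F : System}
    (V : Transformation (System.pi (System.extend A L)) (System.pi (System.extend A' F)))
    (hV : V.IsUnitary) (hinf : ∀ i j, i ≠ j → V.NoInfluence (some i) (some j)) :
    DecomposesSeparably V := by
  obtain ⟨hA, hB, U, hU, hU', hVU⟩ := hV
  have hVm : V.map = conj U := LinearMap.ext hVU
  have hL : L.IsQuantum := System.isQuantum_of_pi hA none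
  have hF : F.IsQuantum := System.isQuantum_of_pi hB none
  have hAi : ∀ i, (A i).IsQuantum := fun i => System.isQuantum_of_pi hA (some i)
  have hA'i : ∀ i, (A' i).IsQuantum := fun i => System.isQuantum_of_pi hB (some i)
  obtain ⟨J, S, R, hJ, hS, hR, hRt, hE⟩ := exists_separable_circuit
    (γ := fun o => (System.extend A L o).Basis) (γ' := fun o => (System.extend A' F o).Basis)
    hn U hU hU' (fun i j hij => by
      obtain ⟨T, -, hT⟩ := hinf i j hij
      rw [hVm] at hT
      exact ⟨T.map, hT⟩)
  let X : Fin n → System := fun _ => System.quantum (L.Basis × (L.Basis × L.Basis))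
  let Y : Fin n → System := fun i =>
    System.quantum ((A i).Basis × (L.Basis × (L.Basis × L.Basis)))
  have hX : ∀ i, (X i).IsQuantum := fun _ => System.isQuantum_quantum _
  have hY : ∀ i, (Y i).IsQuantum := fun _ => System.isQuantum_quantum _
  refine ⟨X, Y, Transformation.ofCP hL (System.IsQuantum.pi hX) (conj J) (isCP_conj _),
    fun i => Transformation.ofCP ((hAi i).prod (hX i)) ((hA'i i).prod (hY i)) (conj (S i))
      (isCP_conj _),
    Transformation.ofCP (System.IsQuantum.pi hY) hF R hR, ?_, ?_, hRt, ?_⟩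
  · intro ρ
    exact trace_conj_of_isometry hJ ρ
  · intro i ρ
    exact trace_conj_of_isometry (hS i) ρ
  · exact hVm.trans hE

end Separable

/-! ### From separable to local dynamics -/

section LocalDynamics

lemma tensorMap_comp_insertRight {ι κ κ' : Type} [Fintype ι] [DecidableEq ι] [Fintype κ]
    [DecidableEq κ] (φ : Op Unit →ₗ[ℂ] Op κ) (T : Op κ →ₗ[ℂ] Op κ') :
    tensorMap LinearMap.id T ∘ₗ insertRight ι φ = insertRight ι (T ∘ₗ φ) := by
  rw [insertRight, insertRight, ← LinearMap.comp_assoc, tensorMap_comp, LinearMap.id_comp]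

lemma insertRight_comp {ι ι' κ : Type} [Fintype ι] [DecidableEq ι] [Fintype ι'] [DecidableEq ι']
    [Fintype κ] [DecidableEq κ] (φ : Op Unit →ₗ[ℂ] Op κ) (D : Op ι →ₗ[ℂ] Op ι') :
    insertRight ι' φ ∘ₗ D = tensorMap D LinearMap.id ∘ₗ insertRight ι φ := by
  have h : relabel (Equiv.prodPUnit ι').symm ∘ₗ D =
      tensorMap D LinearMap.id ∘ₗ relabel (Equiv.prodPUnit ι).symm := by
    refine linearMap_ext_single fun x y => ?_
    ext p q
    simp [relabel_single, tensorMap_single]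
  rw [insertRight, insertRight, LinearMap.comp_assoc, h, ← LinearMap.comp_assoc,
    ← LinearMap.comp_assoc, tensorMap_comp, tensorMap_comp, LinearMap.id_comp, LinearMap.comp_id,
    LinearMap.id_comp, LinearMap.comp_id]

lemma comp_tensorMap_of_absorbs {ι κ μ : Type} [Fintype ι] [DecidableEq ι] [Fintype κ]
    [DecidableEq κ] {S : Op (ι × κ) →ₗ[ℂ] Op μ} {E : Op κ →ₗ[ℂ] Op κ}
    (hS : S ∘ₗ tensorMap LinearMap.id E = S) (D : Op ι →ₗ[ℂ] Op ι) :
    S ∘ₗ tensorMap D E = S ∘ₗ tensorMap D LinearMap.id := by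
  conv_rhs => rw [← hS, LinearMap.comp_assoc, tensorMap_comp, LinearMap.id_comp, LinearMap.comp_id]

lemma relabel_symm_comp_comp_relabel {ι κ ι' κ' : Type} {e : ι ≃ κ} {e' : ι' ≃ κ'}
    {V : Op κ →ₗ[ℂ] Op κ'} {C : Op ι →ₗ[ℂ] Op ι'} (hV : V = relabel e' ∘ₗ C ∘ₗ relabel e.symm) :
    relabel e'.symm ∘ₗ V ∘ₗ relabel e = C := by
  rw [hV]
  calc _ = (relabel e'.symm ∘ₗ relabel e') ∘ₗ C ∘ₗ (relabel e.symm ∘ₗ relabel e) := rfl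
    _ = C := by rw [relabel_symm_comp, relabel_symm_comp, LinearMap.comp_id, LinearMap.id_comp]

/-- Preparing the ancilla of a separable circuit, discarding its ancillary output, and applying
local maps before and after leaves a local circuit. -/
lemma local_of_separable {I : Type} [Fintype I] [DecidableEq I] {α β ξ υ : I → Type} {L F : Type}
    [∀ i, Fintype (α i)] [∀ i, DecidableEq (α i)] [∀ i, Fintype (β i)] [∀ i, DecidableEq (β i)]
    [∀ i, Fintype (ξ i)] [∀ i, DecidableEq (ξ i)] [∀ i, Fintype (υ i)] [∀ i, DecidableEq (υ i)]
    [Fintype L] [DecidableEq L] [Fintype F] [DecidableEq F]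
    (T₀ : Op L →ₗ[ℂ] Op (∀ i, ξ i)) (T : ∀ i, Op (α i × ξ i) →ₗ[ℂ] Op (β i × υ i))
    (R : Op (∀ i, υ i) →ₗ[ℂ] Op F) (hR : ∀ ρ, (R ρ).trace = ρ.trace) (ψ : Op Unit →ₗ[ℂ] Op L)
    (D : ∀ i, Op (α i) →ₗ[ℂ] Op (α i)) (E : ∀ i, Op (β i) →ₗ[ℂ] Op (β i)) :
    piTensorMap E ∘ₗ discardRight (∀ i, β i) F ∘ₗ
      (tensorMap LinearMap.id R ∘ₗ relabel (Equiv.arrowProdEquivProdArrow I β υ) ∘ₗ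
        piTensorMap (α := fun i => α i × ξ i) (β := fun i => β i × υ i) T ∘ₗ
        relabel (Equiv.arrowProdEquivProdArrow I α ξ).symm ∘ₗ tensorMap LinearMap.id T₀) ∘ₗ
      insertRight (∀ i, α i) ψ ∘ₗ piTensorMap D =
    piTensorMap (α := fun i => α i × ξ i)
        (fun i => E i ∘ₗ discardRight (β i) (υ i) ∘ₗ T i ∘ₗ tensorMap (D i) LinearMap.id) ∘ₗ
      relabel (Equiv.arrowProdEquivProdArrow I α ξ).symm ∘ₗ insertRight (∀ i, α i) (T₀ ∘ₗ ψ) := by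
  have h1 : discardRight (∀ i, β i) F ∘ₗ tensorMap LinearMap.id R ∘ₗ
      relabel (Equiv.arrowProdEquivProdArrow I β υ) ∘ₗ
        piTensorMap (α := fun i => α i × ξ i) (β := fun i => β i × υ i) T =
      piTensorMap (α := fun i => α i × ξ i) fun i => discardRight (β i) (υ i) ∘ₗ T i := by
    rw [← LinearMap.comp_assoc, discardRight_comp_tensorMap_id hR,
      discardRight_comp_relabel_piTensorMap (α := fun i => α i × ξ i)]
  have h2 : relabel (Equiv.arrowProdEquivProdArrow I α ξ).symm ∘ₗ tensorMap LinearMap.id T₀ ∘ₗ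
      insertRight (∀ i, α i) ψ ∘ₗ piTensorMap D =
      piTensorMap (α := fun i => α i × ξ i) (β := fun i => α i × ξ i)
        (fun i => tensorMap (D i) LinearMap.id) ∘ₗ
      relabel (Equiv.arrowProdEquivProdArrow I α ξ).symm ∘ₗ
        insertRight (∀ i, α i) (T₀ ∘ₗ ψ) := by
    have h3 := piTensorMap_tensorMap_comp_relabel D fun i => (LinearMap.id : Op (ξ i) →ₗ[ℂ] _)
    rw [piTensorMap_id] at h3
    rw [← LinearMap.comp_assoc (piTensorMap D), tensorMap_comp_insertRight, insertRight_comp,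
      ← LinearMap.comp_assoc _ _ (piTensorMap _), h3, LinearMap.comp_assoc]
  calc _ = piTensorMap E ∘ₗ (discardRight (∀ i, β i) F ∘ₗ tensorMap LinearMap.id R ∘ₗ
        relabel (Equiv.arrowProdEquivProdArrow I β υ) ∘ₗ
        piTensorMap (α := fun i => α i × ξ i) (β := fun i => β i × υ i) T) ∘ₗ
        (relabel (Equiv.arrowProdEquivProdArrow I α ξ).symm ∘ₗ tensorMap LinearMap.id T₀ ∘ₗ
          insertRight (∀ i, α i) ψ ∘ₗ piTensorMap D) := by simp only [LinearMap.comp_assoc]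
    _ = _ := by
      rw [h1, h2, ← LinearMap.comp_assoc, ← LinearMap.comp_assoc, piTensorMap_comp,
        piTensorMap_comp (α := fun i => α i × ξ i) (β := fun i => α i × ξ i)]
      simp only [LinearMap.comp_assoc]

/-- A transformation obtained from a separable one has local dynamics. -/
theorem decomposesLocally_of_obtainedFrom {n : ℕ} {A A' : Fin n → System} {L F : System}
    {T : Transformation (System.pi A) (System.pi A')}
    {V : Transformation (System.pi (System.extend (fun i => (A i).coherent) L))
      (System.pi (System.extend (fun j => (A' j).coherent) F))}
    (hV : DecomposesSeparably V) (hT : ObtainedFrom T V) : DecomposesLocally T := by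
  obtain ⟨X, Y, T₀, S, R, -, hS, hR, hVm⟩ := hV
  obtain ⟨ψ, hψ⟩ := hT
  have habs : ∀ i, (S i).map ∘ₗ ((A i).prod (X i)).decohere =
      (S i).map ∘ₗ tensorMap (A i).decohere LinearMap.id := by
    intro i
    have h1 : (S i).map ∘ₗ tensorMap (LinearMap.id : Op (A i).Basis →ₗ[ℂ] _) (X i).decohere =
        (S i).map := by
      have hc : (A i).coherent.decohere = LinearMap.id := System.IsQuantum.decohere rfl
      have h := (S i).map_decohere
      rw [System.decohere_prod, hc] at h
      exact h
    rw [System.decohere_prod]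
    exact comp_tensorMap_of_absorbs h1 _
  refine ⟨X,
    { map := T₀.map ∘ₗ ψ.map
      cp := T₀.cp.comp ψ.cp
      map_decohere := by rw [LinearMap.comp_assoc, ψ.map_decohere]
      decohere_map := by rw [← LinearMap.comp_assoc, T₀.decohere_map] },
    fun i =>
    { map := (A' i).decohere ∘ₗ discardRight (A' i).Basis (Y i).Basis ∘ₗ (S i).map ∘ₗ
        ((A i).prod (X i)).decohere
      cp := (System.isCP_decohere _).comp (isCP_discardRight.comp ((S i).cp.comp
        (System.isCP_decohere _)))
      map_decohere := congrArg
        (fun f => (A' i).decohere ∘ₗ discardRight (A' i).Basis (Y i).Basis ∘ₗ (S i).map ∘ₗ f)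
        (System.decohere_comp_decohere ((A i).prod (X i)))
      decohere_map := by
        rw [← LinearMap.comp_assoc, System.decohere_comp_decohere] },
    fun i ρ => ?_, ?_⟩
  · exact (System.trace_decohere _ _).trans ((trace_discardRight _).trans ((hS i _).trans
      (System.trace_decohere _ _)))
  · have h := local_of_separable (α := fun i => (A i).Basis) (β := fun i => (A' i).Basis)
      (ξ := fun i => (X i).Basis) (υ := fun i => (Y i).Basis) T₀.map (fun i => (S i).map) R.map hR
      ψ.map (fun i => (A i).decohere) (fun i => (A' i).decohere)
    let C : Op ((∀ i, (A i).Basis) × L.Basis) →ₗ[ℂ] Op ((∀ i, (A' i).Basis) × F.Basis) :=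
      tensorMap (LinearMap.id : Op (∀ i, (A' i).Basis) →ₗ[ℂ] _) R.map ∘ₗ
          relabel (Equiv.arrowProdEquivProdArrow (Fin n) (fun i => (A' i).Basis)
            (fun i => (Y i).Basis)) ∘ₗ
          piTensorMap (α := fun i => (A i).Basis × (X i).Basis)
            (β := fun i => (A' i).Basis × (Y i).Basis) (fun i => (S i).map) ∘ₗ
          relabel (Equiv.arrowProdEquivProdArrow (Fin n) (fun i => (A i).Basis)
            (fun i => (X i).Basis)).symm ∘ₗ
          tensorMap (LinearMap.id : Op (∀ i, (A i).Basis) →ₗ[ℂ] _) T₀.map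
    have hC := relabel_symm_comp_comp_relabel (e := System.extendEquiv (fun i => (A i).coherent) L)
      (e' := System.extendEquiv (fun j => (A' j).coherent) F)
      (C := C) hVm
    have hC' := congrArg (fun f => (System.pi A').decohere ∘ₗ
      discardRight (∀ j, (A' j).Basis) F.Basis ∘ₗ f ∘ₗ insertRight (∀ i, (A i).Basis) ψ.map ∘ₗ
      (System.pi A).decohere) hC
    have hD := congrArg₂ (fun (d : Op (∀ j, (A' j).Basis) →ₗ[ℂ] Op (∀ j, (A' j).Basis))
        (d' : Op (∀ i, (A i).Basis) →ₗ[ℂ] Op (∀ i, (A i).Basis)) =>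
      d ∘ₗ discardRight (∀ j, (A' j).Basis) F.Basis ∘ₗ
        C ∘ₗ
        insertRight (∀ i, (A i).Basis) ψ.map ∘ₗ d')
      (System.decohere_pi A') (System.decohere_pi A)
    refine hψ.trans (hC'.trans (hD.trans (h.trans ?_)))
    have hS' : (fun i => (A' i).decohere ∘ₗ discardRight (A' i).Basis (Y i).Basis ∘ₗ (S i).map ∘ₗ
          ((A i).prod (X i)).decohere) =
        fun i => (A' i).decohere ∘ₗ discardRight (A' i).Basis (Y i).Basis ∘ₗ (S i).map ∘ₗ
          tensorMap (A i).decohere LinearMap.id :=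
      funext fun i => congrArg
        (fun f => (A' i).decohere ∘ₗ discardRight (A' i).Basis (Y i).Basis ∘ₗ f) (habs i)
    exact congrArg (fun f => piTensorMap (α := fun i => (A i).Basis × (X i).Basis) f ∘ₗ
      relabel (Equiv.arrowProdEquivProdArrow (Fin n) (fun i => (A i).Basis)
        (fun i => (X i).Basis)).symm ∘ₗ
      insertRight (∀ i, (A i).Basis) (T₀.map ∘ₗ ψ.map)) hS'.symm

end LocalDynamics

end QPT

end

theorem mainTheorem5 :
    (∀ (n : ℕ), 0 < n → ∀ (A A' : Fin n → QPT.System) (L F : QPT.System)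
      (V : QPT.Transformation (QPT.System.pi (QPT.System.extend A L))
        (QPT.System.pi (QPT.System.extend A' F))),
      V.IsUnitary →
      (∀ i j, i ≠ j → V.NoInfluence (some i) (some j)) →
      QPT.DecomposesSeparably V) ∧
    ∀ Q : QPT.QuantumPerspectivalTheory,
      Q.SeparableDynamics ∧
      (Q.NoSuperluminalInfluences → Q.ConsistentEmbeddings → Q.LocalDynamics) := by
  refine ⟨fun n hn A A' L F V => QPT.decomposesSeparably_of_noInfluence hn V, fun Q => ⟨?_, ?_⟩⟩
  · intro n hn A A' L F V hV hinf
    exact QPT.decomposesSeparably_of_noInfluence hn V hV fun i j hij => not_not.1 (hinf i j hij)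
  · intro hNSI hCE M n hn A A' T E E' hT hsp
    obtain ⟨L, F, V, G, G', hV, hTV, hval, hG, hG'⟩ := hCE M _ _ A A' T E E' hT
    refine QPT.decomposesLocally_of_obtainedFrom
      (QPT.decomposesSeparably_of_noInfluence hn V hV fun i j hij => ?_) hTV
    by_contra hinf
    refine hNSI M _ _ _ _ V G G' hV hval (some i) (some j) hinf ?_
    rw [hG, hG']
    exact (hsp i j hij).2.1
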